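/- Let $R$ be a commutative noetherian ring and let $D^-(R)=D^-(\mathrm{mod}\,R)$ be the derived category of complexes of finitely generated $R$-modules with $H^i=0$ for $i\gg 0$, a tensor triangulated category under $\otimes^{\mathbf L}_R$. A proper thick tensor ideal $\mathcal P$ of $D^-(R)$ is prime if $X\otimes^{\mathbf L}_R Y\in\mathcal P$ implies $X\in\mathcal P$ or $Y\in\mathcal P$. Let $\operatorname{Spc}D^-(R)$ be the set of prime thick tensor ideals, ordered by inclusion, with the topology whose open basis consists of the sets $\{\mathcal P\mid X\in\mathcal P\}$, $X\in D^-(R)$. For $X\in D^-(R)$ put $\operatorname{Spp}X=\{\mathcal P\in\operatorname{Spc}D^-(R)\mid X\notin\mathcal P\}$ and $\operatorname{Supp}X=\bigcup_{n}\operatorname{Supp}_R H^n(X)=\{\mathfrak p\in \operatorname{Spec}R\mid X_{\mathfrak p}\not\cong 0\}$, and for a class $\mathcal X$ of objects put $\operatorname{Supp}\mathcal X=\bigcup_{X\in\mathcal X}\operatorname{Supp}X$. A connected (resp. irreducible) component of a subspace $S$ of a topological space is a maximal nonempty connected (resp. irreducible) subspace of $S$. There is a unique map $\rho:\operatorname{Spc}D^-(R)\to\operatorname{Spec}R$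 such that $\operatorname{Supp}\mathcal P=\{\mathfrak p\in\operatorname{Spec}R\mid \mathfrak p\not\subseteq\rho(\mathcal P)\}$ for all $\mathcal P$; it is continuous and surjective. Moreover, for every $C\in D^-(R)$ with bounded cohomology (that is, $C\in D^b(\mathrm{mod}\,R)$): 1. $U\mapsto\rho(U)$ and $W\mapsto\rho^{-1}(W)$ are mutually inverse bijections between the set of connected components of $\operatorname{Spp}C$ and the set of connected components of $\operatorname{Supp}C$. 2. $U\mapsto\rho(U)$ and $W\mapsto\rho^{-1}(W)$ are mutually inverse bijections between the set of irreducible components of $\operatorname{Spp}C$ and the set of irreducible components of $\operatorname{Supp}C$. More precisely, $\rho$ restricts to a bijection from the set of maximal elements of $\operatorname{Spp}C$ to the set of minimal elements of $\operatorname{Supp}C$; $\mathcal P\mapsto\overline{\{\mathcal P\}}$ is a bijection from the former set to the set of irreducible components of $\operatorname{Spp}C$, $\mathfrak p\mapsto\overline{\{\mathfrak p\}}$ is a bijection from the latter set to the set of irreducible components of $\operatorname{Supp}C$; and $\rho(\overline{\{\mathcal P\}})=\overline{\{\rho(\mathcal P)\}}$ for every maximal element $\mathcal P$ of $\operatorname{Spp}C$.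 -/

import Mathlib

universe w v u

namespace TTGeom

open CategoryTheory Limits MonoidalCategory Opposite

/-- Bounded above complexes have bounded above projective resolutions. -/
theorem exists_quasiIso_projective {C : Type u} [Category.{v} C] [Abelian C]
    [EnoughProjectives C] (K : CochainComplex C ℤ) (n : ℤ) [K.IsStrictlyLE n] :
    ∃ (P : CochainComplex C ℤ) (p : P ⟶ K), QuasiIso p ∧
      (∀ i, Projective (P.X i)) ∧ P.IsStrictlyLE n := by
  let e := CochainComplex.opEquivalence C
  have : (e.functor.obj (op K)).IsStrictlyGE (-n) := by
    rw [CochainComplex.isStrictlyGE_iff]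
    intro i hi
    exact (K.isZero_of_isStrictlyLE n (-i) (by lia)).op
  obtain ⟨L, i, hi, hL, hL'⟩ :=
    CochainComplex.Plus.modelCategoryQuillen.exists_quasiIso_injective (e.functor.obj (op K)) (-n)
  let P : CochainComplex C ℤ := (e.inverse.obj L).unop
  let j : e.functor.obj (op K) ⟶ e.functor.obj (op P) := i ≫ e.counitInv.app L
  have hj : QuasiIso j := by dsimp [j]; infer_instance
  let p : P ⟶ K := (e.functor.preimage j).unop
  have hp : e.functor.map p.op = j := by simp [p]
  have hX : ∀ i, (e.functor.obj (op P)).X i = op (P.X (-i)) := fun i => rfl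
  let ee : e.functor.obj (op P) ≅ L := e.counitIso.app L
  have iX (i : ℤ) : op (P.X i) ≅ L.X (-i) := by
    refine eqToIso ?_ ≪≫ (HomologicalComplex.eval _ _ (-i)).mapIso ee
    simp [hX]
  refine ⟨P, p, ?_, ?_, ?_⟩
  · rw [quasiIso_iff]
    intro m
    obtain ⟨k, rfl⟩ : ∃ k, m = -k := ⟨-m, by lia⟩
    have h := hj.quasiIsoAt k
    rw [← hp, quasiIsoAt_iff' _ (k - 1) k (k + 1) (by simp) (by simp)] at h
    rw [quasiIsoAt_iff' _ (-(k + 1)) (-k) (-(k - 1)) (by simp; lia) (by simp; lia)]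
    exact (ShortComplex.quasiIso_opMap_iff _).1 h
  · intro i
    have := Injective.of_iso (iX i).symm (hL _)
    exact (Injective.projective_iff_injective_op).2 this
  · rw [CochainComplex.isStrictlyLE_iff]
    intro i hi
    exact ((L.isZero_of_isStrictlyGE (-n) (-i) (by lia)).of_iso (iX i)).unop

/-- Coproducts of families with only finitely many nonzero members exist. -/
theorem hasCoproduct_of_isZero {C : Type u} [Category.{v} C] [HasZeroMorphisms C]
    [HasFiniteCoproducts C] {ι : Type w} (X : ι → C) (S : Finset ι)
    (hS : ∀ i, i ∉ S → IsZero (X i)) : HasCoproduct X := by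
  classical
  let Y : S → C := fun i => X i
  let c : Cofan X := Cofan.mk (∐ Y) (fun i =>
    if h : i ∈ S then Sigma.ι Y ⟨i, h⟩ else 0)
  have hc (i : S) : c.inj i.1 = Sigma.ι Y i := by
    simp [c, Cofan.inj]
  refine ⟨⟨c, Cofan.IsColimit.mk c (fun s => Limits.Sigma.desc (f := Y) (fun i => s.inj i.1)) ?_ ?_⟩⟩
  · intro s i
    by_cases h : i ∈ S
    · rw [hc ⟨i, h⟩]; simp
    · exact (hS i h).eq_of_src _ _
  · intro s m hm
    refine Limits.Sigma.hom_ext (f := Y) _ _ ?_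
    intro i
    have := hm i.1
    rw [hc] at this
    simp [this]

instance (R : Type u) [CommRing R] [IsNoetherianRing R] : EnoughProjectives (FGModuleCat.{u} R) where
  presentation M := by
    obtain ⟨n, f, hf⟩ := Module.Finite.exists_fin' R M
    refine ⟨{ p := FGModuleCat.of R (Fin n → R), projective := ⟨?_⟩, f := FGModuleCat.ofHom f, epi := ?_ }⟩
    · intro E X g e he
      have he' : Epi ((forget₂ (FGModuleCat.{u} R) (ModuleCat.{u} R)).map e) := inferInstance
      have hs : Function.Surjective e.hom.hom := (ModuleCat.epi_iff_surjective _).1 he'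
      obtain ⟨h, hh⟩ := Module.projective_lifting_property e.hom.hom g.hom.hom hs
      exact ⟨FGModuleCat.ofHom h, by ext : 1; exact hh⟩
    · have : Epi ((forget₂ (FGModuleCat.{u} R) (ModuleCat.{u} R)).map (FGModuleCat.ofHom f)) :=
        (ModuleCat.epi_iff_surjective _).2 hf
      exact (forget₂ (FGModuleCat.{u} R) (ModuleCat.{u} R)).epi_of_epi_map this


section
variable {C : Type u} [Category.{v} C] [MonoidalCategory C] [Preadditive C] [MonoidalPreadditive C]

/-- The total tensor product of two bounded above complexes exists. -/
theorem hasTensor [HasFiniteCoproducts C] (K L : CochainComplex C ℤ) (a b : ℤ)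
    [K.IsStrictlyLE a] [L.IsStrictlyLE b] : HomologicalComplex.HasTensor K L := by
  classical
  intro n
  refine hasCoproduct_of_isZero _
    (((Finset.Icc (n - b) a ×ˢ Finset.Icc (n - a) b)).subtype _) ?_
  rintro ⟨⟨i, j⟩, hij⟩ h
  replace hij : i + j = n := hij
  by_cases hi : a < i
  · exact (tensorRight (L.X j)).map_isZero (K.isZero_of_isStrictlyLE a i hi)
  · by_cases hj : b < j
    · exact (tensorLeft (K.X i)).map_isZero (L.isZero_of_isStrictlyLE b j hj)
    · exfalso
      apply h
      simp
      lia


/-- The tensor product of bounded above complexes is bounded above. -/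
theorem tensor_isStrictlyLE [HasZeroObject C] (K L : CochainComplex C ℤ) (a b : ℤ) [K.IsStrictlyLE a]
    [L.IsStrictlyLE b] [HomologicalComplex.HasTensor K L] :
    CochainComplex.IsStrictlyLE (HomologicalComplex.tensorObj K L) (a + b) := by
  rw [CochainComplex.isStrictlyLE_iff]
  intro n hn
  rw [IsZero.iff_id_eq_zero]
  apply HomologicalComplex.mapBifunctor.hom_ext
  intro i j h
  replace h : i + j = n := h
  by_cases hi : a < i
  · exact ((tensorRight (L.X j)).map_isZero (K.isZero_of_isStrictlyLE a i hi)).eq_of_src _ _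
  · exact ((tensorLeft (K.X i)).map_isZero
      (L.isZero_of_isStrictlyLE b j (by lia))).eq_of_src _ _
end

section
open HomologicalComplex

theorem tensorHom_comp {C : Type u} [Category.{v} C] [Abelian C] [MonoidalCategory C]
   [MonoidalPreadditive C]
   {K K' K'' L L' L'' : CochainComplex C ℤ} [HasTensor K L]
   [HasTensor K' L'] [HasTensor K'' L''] (f : K ⟶ K') (f' : K' ⟶ K'') (g : L ⟶ L') (g' : L' ⟶ L'') :
   HomologicalComplex.tensorHom f g ≫ HomologicalComplex.tensorHom f' g' =
     HomologicalComplex.tensorHom (f ≫ f') (g ≫ g') := by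
  ext n
  simp [MonoidalCategory.whisker_exchange_assoc]

theorem tensorHom_id {C : Type u} [Category.{v} C] [Abelian C] [MonoidalCategory C]
   [MonoidalPreadditive C]
   {K L : CochainComplex C ℤ} [HasTensor K L] :
   HomologicalComplex.tensorHom (𝟙 K) (𝟙 L) = 𝟙 (tensorObj K L) := by
  ext n
  simp

variable {C : Type u} [Category.{v} C] [Abelian C] [HasDerivedCategory.{w} C]

/-- K-projective complexes that are isomorphic in the derived category are homotopy equivalent. -/
theorem exists_homotopyEquiv_of_Q_iso (K K' : CochainComplex C ℤ) [K.IsKProjective]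
    [K'.IsKProjective] (e : DerivedCategory.Q.obj K ≅ DerivedCategory.Q.obj K') :
    Nonempty (HomotopyEquiv K K') := by
  obtain ⟨f, hf⟩ := (CochainComplex.IsKProjective.Qh_map_bijective K
    ((HomotopyCategory.quotient _ _).obj K')).surjective
      ((DerivedCategory.quotientCompQhIso C).hom.app K ≫ e.hom ≫
        (DerivedCategory.quotientCompQhIso C).inv.app K')
  obtain ⟨g, hg⟩ := (CochainComplex.IsKProjective.Qh_map_bijective K'
    ((HomotopyCategory.quotient _ _).obj K)).surjective
      ((DerivedCategory.quotientCompQhIso C).hom.app K' ≫ e.inv ≫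
        (DerivedCategory.quotientCompQhIso C).inv.app K)
  refine ⟨HomotopyCategory.homotopyEquivOfIso ⟨f, g, ?_, ?_⟩⟩
  · apply (CochainComplex.IsKProjective.Qh_map_bijective K _).injective
    simp [hf, hg]
  · apply (CochainComplex.IsKProjective.Qh_map_bijective K' _).injective
    simp [hf, hg]

/-- The tensor product of complexes respects homotopy equivalences. -/
theorem tensor_Q_iso [MonoidalCategory C] [MonoidalPreadditive C]
   (K K' L L' : CochainComplex C ℤ) [HasTensor K L] [HasTensor K' L']
   (e : HomotopyEquiv K K') (f : HomotopyEquiv L L') : Nonempty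
   (DerivedCategory.Q.obj (HomologicalComplex.tensorObj K L) ≅ 
     DerivedCategory.Q.obj (HomologicalComplex.tensorObj K' L')) := by
  have key : ∀ (K K' L L' : CochainComplex C ℤ) [HasTensor K L] [HasTensor K' L']
     (e : HomotopyEquiv K K') (f : HomotopyEquiv L L'),
     DerivedCategory.Q.map (HomologicalComplex.tensorHom e.hom f.hom) ≫
      DerivedCategory.Q.map (HomologicalComplex.tensorHom e.inv f.inv) = 𝟙 _ := by
    intro K K' L L' _ _ e f
    rw [← Functor.map_comp, tensorHom_comp, ← CategoryTheory.Functor.map_id, ← TTGeom.tensorHom_id]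
    apply DerivedCategory.Q_map_eq_of_homotopy
    exact (mapBifunctorMapHomotopy₁ e.homotopyHomInvId _ _ _).trans
      (mapBifunctorMapHomotopy₂ _ f.homotopyHomInvId _ _)
  exact ⟨⟨_, _, key K K' L L' e f, key K' K L' L e.symm f.symm⟩⟩
end

section DerivedTensor

variable (R : Type u) [CommRing R] [IsNoetherianRing R]

noncomputable instance : HasDerivedCategory.{u + 1} (FGModuleCat.{u} R) :=
  HasDerivedCategory.standard _

/-- `D⁻(mod R)`: the derived category of complexes of finitely generated `R`-modules whose
cohomology vanishes in all large degrees. -/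
abbrev DMinus : Type (u + 1) := DerivedCategory.Minus (FGModuleCat.{u} R)

variable {R}

/-- A projective resolution of `X` in `D⁻(mod R)`: a bounded above cochain complex of finitely
generated projective modules which is isomorphic to `X` in the derived category. -/
structure ProjRes (X : DMinus R) where
  cplx : CochainComplex (FGModuleCat.{u} R) ℤ
  bound : ℤ
  isStrictlyLE : cplx.IsStrictlyLE bound
  projective (i : ℤ) : Projective (cplx.X i)
  iso : DerivedCategory.Q.obj cplx ≅ X.obj

attribute [instance] ProjRes.isStrictlyLE ProjRes.projective

theorem ProjRes.nonempty (X : DMinus R) : Nonempty (ProjRes X) := by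
  obtain ⟨X, n, hn⟩ := X
  obtain ⟨K, _, ⟨e⟩⟩ := DerivedCategory.exists_iso_Q_obj_of_isLE X n
  obtain ⟨P, p, _, hP, hP'⟩ := exists_quasiIso_projective K n
  exact ⟨⟨P, n, hP', hP, asIso (DerivedCategory.Q.map p) ≪≫ e.symm⟩⟩

instance {X : DMinus R} (P : ProjRes X) : P.cplx.IsKProjective :=
  CochainComplex.isKProjective_of_projective P.cplx P.bound

instance {X Y : DMinus R} (P : ProjRes X) (Q : ProjRes Y) :
    HomologicalComplex.HasTensor P.cplx Q.cplx :=
  hasTensor P.cplx Q.cplx P.bound Q.bound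

/-- The total tensor product complex of two projective resolutions, as an object of
`D⁻(mod R)`. -/
noncomputable def ProjRes.tensor {X Y : DMinus R} (P : ProjRes X) (Q : ProjRes Y) : DMinus R :=
  ⟨DerivedCategory.Q.obj (HomologicalComplex.tensorObj P.cplx Q.cplx), P.bound + Q.bound, by
    have := tensor_isStrictlyLE P.cplx Q.cplx P.bound Q.bound
    infer_instance⟩

/-- The derived tensor product `X ⊗ᴸ Y` of two objects of `D⁻(mod R)`, computed with projective
resolutions of `X` and `Y`. -/
noncomputable def derivedTensor (X Y : DMinus R) : DMinus R :=
  (ProjRes.nonempty X).some.tensor (ProjRes.nonempty Y).some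

/-- The derived tensor product does not depend on the resolutions, up to isomorphism. -/
theorem derivedTensor_iso {X Y : DMinus R} (P : ProjRes X) (Q : ProjRes Y) :
    Nonempty (derivedTensor X Y ≅ P.tensor Q) := by
  obtain ⟨e⟩ := exists_homotopyEquiv_of_Q_iso (ProjRes.nonempty X).some.cplx P.cplx
    ((ProjRes.nonempty X).some.iso ≪≫ P.iso.symm)
  obtain ⟨f⟩ := exists_homotopyEquiv_of_Q_iso (ProjRes.nonempty Y).some.cplx Q.cplx
    ((ProjRes.nonempty Y).some.iso ≪≫ Q.iso.symm)
  obtain ⟨g⟩ := tensor_Q_iso _ _ _ _ e f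
  exact ⟨DerivedCategory.Minus.ι.preimageIso g⟩

end DerivedTensor

section Balmer

open Pretriangulated

variable {T : Type u} [Category.{v} T] [HasZeroObject T] [HasShift T ℤ] [Preadditive T]
  [∀ n : ℤ, (shiftFunctor T n).Additive] [Pretriangulated T]

/-- Thick tensor ideals of a triangulated category with a symmetric tensor product `tens`: full
triangulated subcategories which are closed under direct summands (in particular under
isomorphisms) and under tensoring with arbitrary objects. -/
structure IsThickTensorIdeal (tens : T → T → T) (P : ObjectProperty T) : Prop where
  isTriangulated : P.IsTriangulated
  isStableUnderRetracts : P.IsStableUnderRetracts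
  tensor_mem (X Y : T) : P Y → P (tens X Y)

/-- Prime thick tensor ideals. -/
structure IsPrimeThickTensorIdeal (tens : T → T → T) (P : ObjectProperty T) : Prop
    extends IsThickTensorIdeal tens P where
  proper : ∃ X, ¬ P X
  mem_or_mem (X Y : T) : P (tens X Y) → P X ∨ P Y

/-- The Balmer spectrum: the set of prime thick tensor ideals. -/
def BalmerSpectrum (tens : T → T → T) : Type u :=
  {P : ObjectProperty T // IsPrimeThickTensorIdeal tens P}

variable {tens : T → T → T}

/-- The Balmer support of an object: the set of primes not containing it. -/
def spp (tens : T → T → T) (X : T) : Set (BalmerSpectrum tens) := {P | ¬ P.1 X}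

/-- The topology of the Balmer spectrum: the sets `{P | X ∈ P}`, the complements of the supports
`spp X`, form a basis of open sets (they are stable under finite intersections, by direct
sums). -/
instance : TopologicalSpace (BalmerSpectrum tens) :=
  TopologicalSpace.generateFrom {U | ∃ X : T, U = (spp tens X)ᶜ}

/-- Primes are ordered by inclusion. -/
instance : PartialOrder (BalmerSpectrum tens) :=
  inferInstanceAs (PartialOrder {P : ObjectProperty T // IsPrimeThickTensorIdeal tens P})

end Balmer

section Support

variable {R : Type u} [CommRing R] [IsNoetherianRing R]

/-- The Balmer spectrum of `D⁻(mod R)`. -/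
abbrev SpcDMinus (R : Type u) [CommRing R] [IsNoetherianRing R] : Type (u + 1) :=
  BalmerSpectrum (derivedTensor (R := R))

/-- The cohomology module `Hⁿ(X)`. -/
noncomputable abbrev cohomology (X : DMinus R) (n : ℤ) : FGModuleCat.{u} R :=
  (DerivedCategory.homologyFunctor (FGModuleCat.{u} R) n).obj X.obj

/-- The support of a complex: the union of the supports of its cohomology modules, i.e. the set
of all primes `p` such that the (exact) localization of `X` at `p` is nonzero. -/
def supp (X : DMinus R) : Set (PrimeSpectrum R) :=
  ⋃ n : ℤ, Module.support R (cohomology X n)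

/-- The support of a class of complexes. -/
def suppClass (P : ObjectProperty (DMinus R)) : Set (PrimeSpectrum R) :=
  ⋃ (X : DMinus R) (_ : P X), supp X

/-- `X` has bounded cohomology, i.e. it is an object of `D^b(mod R)`. -/
def IsBounded (X : DMinus R) : Prop :=
  (DerivedCategory.TStructure.t (C := FGModuleCat.{u} R)).bounded X.obj

/-- The characterization of the comparison map `ρ : Spc D⁻(mod R) → Spec R`: the support of a
prime thick tensor ideal `P` consists of the primes which are not contained in `ρ P`. -/
def IsComparisonMap (ρ : SpcDMinus R → PrimeSpectrum R) : Prop :=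
  ∀ P : SpcDMinus R, suppClass P.1 = {p | ¬ p.asIdeal ≤ (ρ P).asIdeal}

end Support

section Components

variable {X : Type u} [TopologicalSpace X]

/-- The connected components of a subspace `S`: its maximal connected subspaces. -/
def connComponents (S : Set X) : Set (Set X) := {U | Maximal (fun Z => Z ⊆ S ∧ IsConnected Z) U}

/-- The irreducible components of a subspace `S`: its maximal irreducible subspaces. -/
def irredComponents (S : Set X) : Set (Set X) :=
  {U | Maximal (fun Z => Z ⊆ S ∧ IsIrreducible Z) U}

end Components

end TTGeom

/-! A prime `P` is governed by the cyclic modules `R ⧸ q` it contains. By dévissage, a bounded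
complex lies in `P` as soon as `R ⧸ q` does for every `q` in its support (`prop_of_isBounded`). Not
all `R ⧸ q` lie in `P`, so there is a prime `m` maximal with `R ⧸ m` outside `P`, and two arguments
show that `ρ P = m` works.

If `R ⧸ q` is outside `P` and `x ∈ q` is not in `m`, the cone of `x` on `R ⧸ m` is a module
supported strictly above `m`, hence in `P`. That cone is `R ⧸ m ⊗ K(x)`, so primeness puts the
Koszul complex `K(x)` in `P`. Since `x` kills `R ⧸ q`, the latter is a retract of `R ⧸ q ⊗ K(x)`, a
contradiction. So `q ≤ m` (`le_of_maximal`). If `X ∈ P` were supported at `m`, then, after a shift,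
multiplication by some `s ∉ m` on `R ⧸ m` would factor through `R ⧸ m ⊗ X`, while its cone is in
`P`. This forces `R ⧸ m ∈ P` (`notMem_supp_of_prop`).

The complexes vanishing at `p` form a prime `localPrime p`, by the tensor formula for supports.
Localization is replaced throughout by scalars outside `p`: over a complex of projectives such a
scalar is homotopic to a map vanishing in the degrees from a given one upwards, if the homology
there is not supported at `p` (`exists_homotopy_smul`).

`localPrime p` is the greatest point of the fibre of `ρ` over `p`, and closures in the Balmer
spectrum are down-sets, so `ρ` pulls `closure {p}` back to `closure {localPrime p}`. For bounded `C`
dévissage gives `Spp C = ρ⁻¹(Supp C)` (`IsComparisonMap.spp_eq`), and the rest is topology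
(`components_transfer`). -/

namespace TTGeom

open CategoryTheory Limits MonoidalCategory Opposite

/-! ### Connected and irreducible components along a surjection. -/

section ComponentTransfer

/-- Components of subspaces correspond under a surjection that preserves the defining property of
components and along which components pull back to sets with that property. -/
theorem maximal_image_preimage {X Y : Type*} {f : X → Y} (hf : Function.Surjective f)
    {p : Set X → Prop} {q : Set Y → Prop} {S : Set Y}
    (hpq : ∀ U, p U → q (f '' U))
    (hqp : ∀ W, Maximal (fun Z => Z ⊆ S ∧ q Z) W → p (f ⁻¹' W))
    (hex : ∀ Z, Z ⊆ S → q Z → ∃ W, Z ⊆ W ∧ Maximal (fun Z => Z ⊆ S ∧ q Z) W) :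
    Set.BijOn (fun U => f '' U) {U | Maximal (fun Z => Z ⊆ f ⁻¹' S ∧ p Z) U}
        {W | Maximal (fun Z => Z ⊆ S ∧ q Z) W} ∧
      Set.BijOn (fun W => f ⁻¹' W) {W | Maximal (fun Z => Z ⊆ S ∧ q Z) W}
        {U | Maximal (fun Z => Z ⊆ f ⁻¹' S ∧ p Z) U} ∧
      Set.InvOn (fun W => f ⁻¹' W) (fun U => f '' U)
        {U | Maximal (fun Z => Z ⊆ f ⁻¹' S ∧ p Z) U} {W | Maximal (fun Z => Z ⊆ S ∧ q Z) W} := by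
  have hpre : ∀ W, Maximal (fun Z => Z ⊆ S ∧ q Z) W →
      Maximal (fun Z => Z ⊆ f ⁻¹' S ∧ p Z) (f ⁻¹' W) := by
    intro W hW
    refine ⟨⟨Set.preimage_mono hW.prop.1, hqp W hW⟩, fun U hU hWU => ?_⟩
    have h : f '' U ⊆ W := by
      refine hW.le_of_ge ⟨Set.image_subset_iff.2 hU.1, hpq U hU.2⟩ ?_
      rw [← Set.image_preimage_eq W hf]
      exact Set.image_mono hWU
    exact Set.image_subset_iff.1 h
  -- The image of `U` lies in some component `W`; the preimage of `W` is again admissible and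
  -- contains `U`, so maximality gives equality.
  have him : ∀ U, Maximal (fun Z => Z ⊆ f ⁻¹' S ∧ p Z) U →
      ∃ W, Maximal (fun Z => Z ⊆ S ∧ q Z) W ∧ U = f ⁻¹' W := by
    intro U hU
    obtain ⟨W, hUW, hW⟩ := hex (f '' U) (Set.image_subset_iff.2 hU.prop.1) (hpq U hU.prop.2)
    exact ⟨W, hW, hU.eq_of_subset (hpre W hW).prop (Set.image_subset_iff.1 hUW)⟩
  have hinv : Set.InvOn (fun W => f ⁻¹' W) (fun U => f '' U)
      {U | Maximal (fun Z => Z ⊆ f ⁻¹' S ∧ p Z) U} {W | Maximal (fun Z => Z ⊆ S ∧ q Z) W} := by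
    refine ⟨fun U hU => ?_, fun W _ => Set.image_preimage_eq W hf⟩
    obtain ⟨W, _, rfl⟩ := him U hU
    simp only [Set.image_preimage_eq W hf]
  have hm : Set.MapsTo (fun U => f '' U) {U | Maximal (fun Z => Z ⊆ f ⁻¹' S ∧ p Z) U}
      {W | Maximal (fun Z => Z ⊆ S ∧ q Z) W} := by
    intro U hU
    obtain ⟨W, hW, rfl⟩ := him U hU
    have h : Maximal (fun Z => Z ⊆ S ∧ q Z) (f '' (f ⁻¹' W)) := by
      rwa [Set.image_preimage_eq W hf]
    exact h
  exact ⟨hinv.bijOn hm hpre, hinv.symm.bijOn hpre hm, hinv⟩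

theorem exists_connComponents_superset {Y : Type u} [TopologicalSpace Y] {S Z : Set Y}
    (hZ : Z ⊆ S) (hc : IsConnected Z) : ∃ W, Z ⊆ W ∧ W ∈ connComponents S := by
  obtain ⟨z, hz⟩ := hc.nonempty
  refine ⟨connectedComponentIn S z, hc.isPreconnected.subset_connectedComponentIn hz hZ,
    ⟨connectedComponentIn_subset S z, ⟨z, mem_connectedComponentIn (hZ hz)⟩,
      isPreconnected_connectedComponentIn⟩, fun V hV h => ?_⟩
  exact hV.2.isPreconnected.subset_connectedComponentIn
    (h (mem_connectedComponentIn (hZ hz))) hV.1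

/-- The closure of a connected set is connected and stays inside the closed set `S`, so maximality
absorbs it. -/
theorem isClosed_of_mem_connComponents {Y : Type u} [TopologicalSpace Y] {S W : Set Y}
    (hS : IsClosed S) (hW : W ∈ connComponents S) : IsClosed W := by
  replace hW : Maximal (fun Z => Z ⊆ S ∧ IsConnected Z) W := hW
  have h : closure W ⊆ W := hW.le_of_ge
    ⟨closure_minimal hW.prop.1 hS, hW.prop.2.closure⟩ subset_closure
  exact isClosed_of_closure_subset h

theorem isClosed_of_mem_irredComponents {Y : Type u} [TopologicalSpace Y] {S W : Set Y}
    (hS : IsClosed S) (hW : W ∈ irredComponents S) : IsClosed W := by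
  replace hW : Maximal (fun Z => Z ⊆ S ∧ IsIrreducible Z) W := hW
  have h : closure W ⊆ W := hW.le_of_ge
    ⟨closure_minimal hW.prop.1 hS, hW.prop.2.closure⟩ subset_closure
  exact isClosed_of_closure_subset h

/-- Closed connected subsets of a noetherian space have connected preimages under a surjection
along which irreducible closed subsets have irreducible preimages. -/
theorem isConnected_preimage {X Y : Type*} [TopologicalSpace X] [TopologicalSpace Y]
    [TopologicalSpace.NoetherianSpace Y] {f : X → Y} (hf : Function.Surjective f)
    (hirr : ∀ Z : Set Y, IsClosed Z → IsIrreducible Z → IsIrreducible (f ⁻¹' Z))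
    {W : Set Y} (hW : IsClosed W) (hc : IsConnected W) : IsConnected (f ⁻¹' W) := by
  refine ⟨hc.nonempty.preimage hf, ?_⟩
  rw [isPreconnected_closed_iff]
  intro t t' ht ht' hsub hn hn'
  by_contra hemp
  obtain ⟨F, hF, hFc, hFi, hWF⟩ :=
    TopologicalSpace.NoetherianSpace.exists_finite_set_isClosed_irreducible hW
  have hcov : ∀ Z ∈ F, f ⁻¹' Z ⊆ t ∨ f ⁻¹' Z ⊆ t' := by
    intro Z hZ
    refine isPreirreducible_iff_isClosed_union_isClosed.1 (hirr Z (hFc Z hZ) (hFi Z hZ)).2 t t' ht ht' ?_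
    exact (Set.preimage_mono (hWF ▸ Set.subset_sUnion_of_mem hZ)).trans hsub
  -- Each irreducible piece has its whole preimage in `t` or in `t'`. Collecting the pieces
  -- accordingly gives closed sets (finite unions) covering `W`, so a separation upstairs descends
  -- to one of `W`.
  let T (t : Set X) : Set Y := ⋃ Z ∈ {Z ∈ F | f ⁻¹' Z ⊆ t}, Z
  have hTc : ∀ t, IsClosed (T t) := fun t =>
    (hF.subset (Set.sep_subset _ _)).isClosed_biUnion fun Z hZ => hFc Z hZ.1
  have hTp : ∀ t, f ⁻¹' T t ⊆ t := by
    intro t P hP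
    simp only [T, Set.mem_preimage, Set.mem_iUnion] at hP
    obtain ⟨Z, hZ, hPZ⟩ := hP
    exact hZ.2 hPZ
  have hWT : W ⊆ T t ∪ T t' := by
    intro y hy
    obtain ⟨Z, hZ, hyZ⟩ := (hWF ▸ hy : y ∈ ⋃₀ F)
    rcases hcov Z hZ with h | h
    · exact Or.inl (Set.mem_biUnion (show Z ∈ {Z ∈ F | f ⁻¹' Z ⊆ t} from ⟨hZ, h⟩) hyZ)
    · exact Or.inr (Set.mem_biUnion (show Z ∈ {Z ∈ F | f ⁻¹' Z ⊆ t'} from ⟨hZ, h⟩) hyZ)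
  have h1 : (W ∩ T t).Nonempty := by
    obtain ⟨P, hP, hPt⟩ := hn
    rcases hWT hP with h | h
    · exact ⟨f P, hP, h⟩
    · exact (hemp ⟨P, hP, hPt, hTp t' h⟩).elim
  have h2 : (W ∩ T t').Nonempty := by
    obtain ⟨P, hP, hPt⟩ := hn'
    rcases hWT hP with h | h
    · exact (hemp ⟨P, hP, hTp t h, hPt⟩).elim
    · exact ⟨f P, hP, h⟩
  obtain ⟨y, hy, hyt, hyt'⟩ :=
    isPreconnected_closed_iff.1 hc.isPreconnected _ _ (hTc t) (hTc t') hWT h1 h2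
  obtain ⟨P, rfl⟩ := hf y
  exact hemp ⟨P, hy, hTp t hyt, hTp t' hyt'⟩

end ComponentTransfer

/-! ### Irreducible components in the prime spectrum, and the transfer statement. -/

section SpectrumComponents

variable {R : Type u} [CommRing R]

theorem exists_minimal_le_of_isClosed {S : Set (PrimeSpectrum R)} (hS : IsClosed S)
    {q : PrimeSpectrum R} (hq : q ∈ S) : ∃ p ≤ q, Minimal (· ∈ S) p := by
  obtain ⟨I, rfl⟩ := (PrimeSpectrum.isClosed_iff_zeroLocus_ideal S).1 hS
  obtain ⟨p, hp, hpq⟩ := Ideal.exists_minimalPrimes_le (I := I) (J := q.asIdeal) hq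
  exact ⟨⟨p, hp.1.1⟩, hpq, hp.1.2, fun r hr hrp => hp.2 ⟨r.2, hr⟩ hrp⟩

theorem exists_eq_closure_of_isIrreducible {Z : Set (PrimeSpectrum R)} (hZ : IsClosed Z)
    (hi : IsIrreducible Z) : ∃ q, Z = closure {q} := by
  obtain ⟨q, hq⟩ := QuasiSober.sober hi hZ
  exact ⟨q, hq.symm⟩

/-- The generic point of the closure of a larger irreducible subset lies in `S` and below `p`, hence
equals `p`. -/
theorem closure_mem_irredComponents {S : Set (PrimeSpectrum R)} (hS : IsClosed S)
    {p : PrimeSpectrum R} (hp : Minimal (· ∈ S) p) : closure {p} ∈ irredComponents S := by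
  refine ⟨⟨closure_minimal (by simpa using hp.prop) hS, isIrreducible_singleton.closure⟩,
    fun V hV h => ?_⟩
  obtain ⟨q, hq⟩ := exists_eq_closure_of_isIrreducible isClosed_closure hV.2.closure
  have hqS : q ∈ S := closure_minimal hV.1 hS (hq ▸ subset_closure rfl)
  have hqp : q ≤ p := by
    rw [PrimeSpectrum.le_iff_mem_closure, ← hq]
    exact subset_closure (h (subset_closure rfl))
  rw [← hp.eq_of_le hqS hqp, ← hq]
  exact subset_closure

theorem exists_minimal_of_isIrreducible {S Z : Set (PrimeSpectrum R)} (hS : IsClosed S)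
    (hZS : Z ⊆ S) (hi : IsIrreducible Z) : ∃ p, Z ⊆ closure {p} ∧ Minimal (· ∈ S) p := by
  obtain ⟨q, hq⟩ := exists_eq_closure_of_isIrreducible isClosed_closure hi.closure
  have hqS : q ∈ S := closure_minimal hZS hS (hq ▸ subset_closure rfl)
  obtain ⟨p, hpq, hp⟩ := exists_minimal_le_of_isClosed hS hqS
  refine ⟨p, subset_closure.trans ?_, hp⟩
  rw [hq]
  refine closure_minimal ?_ isClosed_closure
  simpa [PrimeSpectrum.le_iff_mem_closure] using hpq

theorem exists_closure_eq_of_mem_irredComponents {S W : Set (PrimeSpectrum R)} (hS : IsClosed S)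
    (hW : W ∈ irredComponents S) : ∃ p, Minimal (· ∈ S) p ∧ W = closure {p} := by
  replace hW : Maximal (fun Z => Z ⊆ S ∧ IsIrreducible Z) W := hW
  obtain ⟨p, hWp, hp⟩ := exists_minimal_of_isIrreducible hS hW.prop.1 hW.prop.2
  have h : Maximal (fun Z => Z ⊆ S ∧ IsIrreducible Z) (closure {p}) :=
    closure_mem_irredComponents hS hp
  exact ⟨p, hp, hW.eq_of_subset h.prop hWp⟩

theorem bijOn_closure_minimal {S : Set (PrimeSpectrum R)} (hS : IsClosed S) :
    Set.BijOn (fun p => closure {p}) {p | Minimal (· ∈ S) p} (irredComponents S) := by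
  refine ⟨fun p hp => closure_mem_irredComponents hS hp, fun p _ q _ h => ?_, fun W hW => ?_⟩
  · exact ((specializes_iff_closure_subset.2 h.ge).antisymm
      (specializes_iff_closure_subset.2 h.le)).eq
  · obtain ⟨p, hp, rfl⟩ := exists_closure_eq_of_mem_irredComponents hS hW
    exact ⟨p, hp, rfl⟩

/-- Transfer of components along a continuous surjection onto a noetherian spectrum with an
order reversing section `s` for which `ρ P = ρ (s (ρ P))` and `P ≤ s (ρ P)`. -/
theorem components_transfer [IsNoetherianRing R] {X : Type w} [TopologicalSpace X] [PartialOrder X]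
    (hcl : ∀ P : X, closure {P} = Set.Iic P) {ρ : X → PrimeSpectrum R} (hρ : Continuous ρ)
    {s : PrimeSpectrum R → X} (hs : ∀ p, ρ (s p) = p) (hle : ∀ P, P ≤ s (ρ P))
    (hρa : ∀ P Q, P ≤ Q → ρ Q ≤ ρ P) (hsa : ∀ p q, p ≤ q → s q ≤ s p)
    {S : Set (PrimeSpectrum R)} (hS : IsClosed S) :
    (Set.BijOn (fun U => ρ '' U) (connComponents (ρ ⁻¹' S)) (connComponents S) ∧
      Set.BijOn (fun W => ρ ⁻¹' W) (connComponents S) (connComponents (ρ ⁻¹' S)) ∧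
      Set.InvOn (fun W => ρ ⁻¹' W) (fun U => ρ '' U)
        (connComponents (ρ ⁻¹' S)) (connComponents S)) ∧
    (Set.BijOn (fun U => ρ '' U) (irredComponents (ρ ⁻¹' S)) (irredComponents S) ∧
      Set.BijOn (fun W => ρ ⁻¹' W) (irredComponents S) (irredComponents (ρ ⁻¹' S)) ∧
      Set.InvOn (fun W => ρ ⁻¹' W) (fun U => ρ '' U)
        (irredComponents (ρ ⁻¹' S)) (irredComponents S)) ∧
    (Set.BijOn ρ {P | Maximal (fun Q => Q ∈ ρ ⁻¹' S) P} {p | Minimal (fun q => q ∈ S) p} ∧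
      Set.BijOn (fun P => closure {P}) {P | Maximal (fun Q => Q ∈ ρ ⁻¹' S) P}
        (irredComponents (ρ ⁻¹' S)) ∧
      Set.BijOn (fun p => closure {p}) {p | Minimal (fun q => q ∈ S) p} (irredComponents S) ∧
      ∀ P, Maximal (fun Q => Q ∈ ρ ⁻¹' S) P → ρ '' closure {P} = closure {ρ P}) := by
  have hsurj : Function.Surjective ρ := fun p => ⟨s p, hs p⟩
  have hpre : ∀ q, ρ ⁻¹' closure {q} = closure {s q} := by
    intro q
    ext P
    rw [hcl, Set.mem_preimage, ← PrimeSpectrum.le_iff_mem_closure, Set.mem_Iic]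
    exact ⟨fun h => (hle P).trans (hsa _ _ h), fun h => (hs q).ge.trans (hρa _ _ h)⟩
  have hirr : ∀ Z, IsClosed Z → IsIrreducible Z → IsIrreducible (ρ ⁻¹' Z) := by
    intro Z hZ hi
    obtain ⟨q, rfl⟩ := exists_eq_closure_of_isIrreducible hZ hi
    rw [hpre]
    exact isIrreducible_singleton.closure
  -- Since `s (ρ P)` lies above `P` in the same fibre, a maximal `P` must be `s (ρ P)`.
  have hmax : ∀ P, Maximal (fun Q => Q ∈ ρ ⁻¹' S) P → P = s (ρ P) ∧ Minimal (· ∈ S) (ρ P) := by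
    intro P hP
    have h : P = s (ρ P) := hP.eq_of_le (by simpa [hs] using hP.prop) (hle P)
    refine ⟨h, hP.prop, fun q hq hqp => ?_⟩
    have h' : P = s q :=
      hP.eq_of_le (by simpa [hs] using hq) (h.le.trans (hsa _ _ hqp))
    rw [h', hs]
  have hmin : ∀ p, Minimal (· ∈ S) p → Maximal (fun Q => Q ∈ ρ ⁻¹' S) (s p) := by
    intro p hp
    refine ⟨by simpa [hs] using hp.prop, fun Q hQ h => ?_⟩
    have h' : ρ Q = p := hp.eq_of_ge hQ ((hρa _ _ h).trans (hs p).le) |>.symm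
    exact (hle Q).trans (by rw [h'])
  have hI := maximal_image_preimage hsurj (p := IsIrreducible) (q := IsIrreducible) (S := S)
    (fun U hU => hU.image ρ hρ.continuousOn)
    (fun W hW => hirr W (isClosed_of_mem_irredComponents hS hW) hW.prop.2)
    (fun Z hZ hi => by
      obtain ⟨p, hZp, hp⟩ := exists_minimal_of_isIrreducible hS hZ hi
      exact ⟨_, hZp, closure_mem_irredComponents hS hp⟩)
  refine ⟨?_, hI, ?_, ?_, bijOn_closure_minimal hS, ?_⟩
  · exact maximal_image_preimage hsurj (p := IsConnected) (q := IsConnected)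
      (fun U hU => hU.image ρ hρ.continuousOn)
      (fun W hW => isConnected_preimage hsurj hirr (isClosed_of_mem_connComponents hS hW)
        hW.prop.2)
      (fun Z hZ hc => exists_connComponents_superset hZ hc)
  · refine ⟨fun P hP => (hmax P hP).2, fun P hP Q hQ h => ?_, fun p hp => ⟨s p, hmin p hp, hs p⟩⟩
    rw [(hmax P hP).1, (hmax Q hQ).1, h]
  · refine ⟨fun P hP => ?_, fun P _ Q _ h => ?_, fun U hU => ?_⟩
    · have h := hI.2.1.mapsTo (closure_mem_irredComponents hS (hmax P hP).2)
      rw [hpre, ← (hmax P hP).1] at h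
      exact h
    · simp only [hcl] at h
      exact Set.Iic_injective h
    · obtain ⟨W, hW, rfl⟩ := hI.2.1.surjOn hU
      obtain ⟨p, hp, rfl⟩ := exists_closure_eq_of_mem_irredComponents hS hW
      exact ⟨s p, hmin p hp, (hpre p).symm⟩
  · intro P hP
    have h := hpre (ρ P)
    rw [← (hmax P hP).1] at h
    rw [← h, Set.image_preimage_eq _ hsurj]

end SpectrumComponents

/-! ### Closures in the Balmer spectrum. -/

section BalmerTopology

open Pretriangulated

variable {T : Type u} [Category.{v} T] [HasZeroObject T] [HasShift T ℤ] [Preadditive T]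
  [∀ n : ℤ, (shiftFunctor T n).Additive] [Pretriangulated T] {tens : T → T → T}

theorem isClosed_spp (X : T) : IsClosed (spp tens X) :=
  ⟨TopologicalSpace.isOpen_generateFrom_of_mem ⟨X, rfl⟩⟩

/-- The closure of a point of the Balmer spectrum consists of the smaller primes. -/
theorem closure_singleton_eq_Iic (P : BalmerSpectrum tens) : closure {P} = Set.Iic P := by
  ext Q
  constructor
  · intro h X hX
    by_contra hP
    exact closure_minimal (Set.singleton_subset_iff.2 (show P ∈ spp tens X from hP))
      (isClosed_spp X) h hX
  · intro h
    rw [← specializes_iff_mem_closure, Specializes, TopologicalSpace.nhds_generateFrom (a := Q)]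
    refine le_iInf₂ fun U hU => Filter.le_principal_iff.2 ?_
    obtain ⟨hQ, X, rfl⟩ := hU
    exact (isClosed_spp X).isOpen_compl.mem_nhds fun hP => hQ fun hX => hP (h X hX)

end BalmerTopology

/-! ### Scalars outside a prime as a substitute for localization. -/

section Annihilation

variable {R : Type u} [CommRing R]

/-- A prime is outside the support of a finitely generated module if and only if some scalar
outside of the prime annihilates the module. -/
theorem notMem_support_iff_exists_smul_id (M : FGModuleCat.{u} R) (p : PrimeSpectrum R) :
    p ∉ Module.support R M ↔ ∃ s ∉ p.asIdeal, s • 𝟙 M = 0 := by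
  rw [Module.mem_support_iff_of_finite, SetLike.not_le_iff_exists]
  refine exists_congr fun s => ?_
  rw [and_comm, Module.mem_annihilator]
  refine and_congr_right fun _ => ⟨fun h => ?_, fun h m => ?_⟩
  · ext m
    exact h m
  · exact DFunLike.congr_fun (congr_arg (fun f => f.hom.hom) h) m

theorem support_eq_of_iso {M N : FGModuleCat.{u} R} (e : M ≅ N) :
    Module.support R M = Module.support R N :=
  (FGModuleCat.isoToLinearEquiv e).support_eq

variable [IsNoetherianRing R]

/-- Maps from a projective object to the cycles which vanish in homology are boundaries. -/
theorem exists_lift_of_comp_homologyπ_eq_zero {C : Type*} [Category* C] [Abelian C]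
    (F : CochainComplex C ℤ) {A : C} [Projective A] (i j : ℤ) (hij : i + 1 = j)
    (f : A ⟶ F.cycles j) (hf : f ≫ F.homologyπ j = 0) : ∃ h : A ⟶ F.X i, h ≫ F.toCycles i j = f := by
  have hex := ShortComplex.exact_of_g_is_cokernel
    (ShortComplex.mk (F.toCycles i j) (F.homologyπ j) (by simp))
    (F.homologyIsCokernel i j (by simp [← hij]))
  exact ⟨hex.liftFromProjective f hf, hex.liftFromProjective_comp f hf⟩

/-- A map from the term `F.X j` to `F.X i` with `i + 1 = j` gives a null-homotopic endomorphism. -/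
theorem exists_nullHomotopic {C : Type*} [Category* C] [Preadditive C]
    (F : CochainComplex C ℤ) (i j : ℤ) (hij : i + 1 = j) (h : F.X j ⟶ F.X i) :
    ∃ ψ : F ⟶ F, Nonempty (Homotopy ψ 0) ∧ ψ.f j = h ≫ F.d i j ∧ ∀ k, j < k → ψ.f k = 0 := by
  let hh (k l : ℤ) : F.X k ⟶ F.X l :=
    if hkl : k = j ∧ l = i then
      eqToHom (by rw [hkl.1]) ≫ h ≫ eqToHom (by rw [hkl.2]) else 0
  have hj : hh j i = h := by simp [hh]
  refine ⟨Homotopy.nullHomotopicMap hh, ⟨Homotopy.nullHomotopy hh fun k l hkl => ?_⟩, ?_, ?_⟩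
  · refine dif_neg ?_
    rintro ⟨rfl, rfl⟩
    exact hkl hij
  · rw [Homotopy.nullHomotopicMap_f (k₂ := i) (k₁ := j) (k₀ := j + 1) hij rfl, hj]
    have : hh (j + 1) j = 0 := dif_neg (by lia)
    rw [this, comp_zero, zero_add]
  · intro k hk
    rw [Homotopy.nullHomotopicMap_f (k₂ := k - 1) (k₁ := k) (k₀ := k + 1) (by simp) rfl]
    have h1 : hh (k + 1) k = 0 := dif_neg (by lia)
    have h2 : hh k (k - 1) = 0 := dif_neg (by lia)
    rw [h1, h2, comp_zero, zero_comp, zero_add]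

/-- If the cohomology of a bounded above complex of projectives is not supported at `p` in degrees
`≥ k`, then a scalar outside of `p` is homotopic to a map vanishing in degrees `≥ k`. -/
theorem exists_homotopy_smul (F : CochainComplex (FGModuleCat.{u} R) ℤ)
    [∀ i, Projective (F.X i)] (b : ℤ) [F.IsStrictlyLE b] (p : PrimeSpectrum R) (k : ℤ)
    (hk : ∀ i, k ≤ i → p ∉ Module.support R (F.homology i)) :
    ∃ s ∉ p.asIdeal, ∃ φ : F ⟶ F, Nonempty (Homotopy φ (s • 𝟙 F)) ∧ ∀ i, k ≤ i → φ.f i = 0 := by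
  have hbig : ∀ n, b + 1 ≤ n → ∃ s ∉ p.asIdeal, ∃ φ : F ⟶ F,
      Nonempty (Homotopy φ (s • 𝟙 F)) ∧ ∀ i, n ≤ i → φ.f i = 0 := fun n hn =>
    ⟨1, (Ideal.ne_top_iff_one _).1 p.2.ne_top, 𝟙 F, ⟨Homotopy.ofEq (by simp)⟩, fun i hi =>
      (F.isZero_of_isStrictlyLE b i (by lia)).eq_of_src _ _⟩
  -- Downward induction from `b + 1`, where the identity already vanishes.
  have key : ∀ n, n ≤ b + 1 → k ≤ n → ∃ s ∉ p.asIdeal, ∃ φ : F ⟶ F,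
      Nonempty (Homotopy φ (s • 𝟙 F)) ∧ ∀ i, n ≤ i → φ.f i = 0 := by
    intro n hn
    induction n, hn using Int.leInductionDown with
    | base => exact fun _ => hbig _ le_rfl
    | pred n hn ih =>
      intro hkn
      obtain ⟨s, hs, φ, ⟨H⟩, hφ⟩ := ih (by lia)
      obtain ⟨t, ht, ht0⟩ := (notMem_support_iff_exists_smul_id _ _).1 (hk (n - 1) hkn)
      have hd : φ.f (n - 1) ≫ F.d (n - 1) n = 0 := by
        rw [φ.comm, hφ n le_rfl, comp_zero]
      -- As `φ` vanishes in degree `n`, its component in degree `n - 1` takes values in cycles.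
      -- After multiplication by `t` these are boundaries, and projectivity lifts them to a map `h`;
      -- subtracting the null-homotopic map built from `h` clears degree `n - 1`.
      obtain ⟨h, hh⟩ := exists_lift_of_comp_homologyπ_eq_zero F (n - 2) (n - 1) (by lia)
        (t • F.liftCycles (φ.f (n - 1)) n (by simp) hd) (by
          rw [Linear.smul_comp, ← Linear.comp_smul, ← Category.comp_id (F.homologyπ (n - 1)),
            ← Linear.comp_smul, ht0, comp_zero, comp_zero])
      obtain ⟨ψ, ⟨Hψ⟩, hψ, hψ'⟩ := exists_nullHomotopic F (n - 2) (n - 1) (by lia) h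
      refine ⟨t * s, fun hts => (p.2.mem_or_mem hts).elim ht hs, t • φ + (-1 : R) • ψ,
        ⟨((H.smul t).add (Hψ.smul (-1 : R))).trans (Homotopy.ofEq (by simp [mul_smul]))⟩, fun i hi => ?_⟩
      rcases hi.eq_or_lt with rfl | hi
      · rw [HomologicalComplex.add_f_apply, HomologicalComplex.smul_f_apply,
            HomologicalComplex.smul_f_apply, hψ,
          ← F.toCycles_i, reassoc_of% hh]
        simp
      · rw [HomologicalComplex.add_f_apply, HomologicalComplex.smul_f_apply,
            HomologicalComplex.smul_f_apply, hψ' i hi,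
          hφ i (by lia)]
        simp
  rcases le_total k (b + 1) with h | h
  · exact key k h le_rfl
  · exact hbig k h

end Annihilation

/-! ### Differential, functionals and cycles on the total tensor product. -/

section TensorDifferential

open HomologicalComplex

variable {C : Type u} [Category.{v} C] [MonoidalCategory C] [Preadditive C]
  [MonoidalPreadditive C] (F G : CochainComplex C ℤ) [HasTensor F G]

theorem ι_tensor_d (i j n n' : ℤ) (h : i + j = n) (hn : n + 1 = n') :
    ιTensorObj F G i j n h ≫ (tensorObj F G).d n n' =
      F.d i (i + 1) ▷ G.X j ≫ ιTensorObj F G (i + 1) j n' (by lia) +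
        i.negOnePow • (F.X i ◁ G.d j (j + 1) ≫ ιTensorObj F G i (j + 1) n' (by lia)) := by
  subst hn
  rw [mapBifunctor.d_eq, Preadditive.comp_add, mapBifunctor.ι_D₁, mapBifunctor.ι_D₂,
    mapBifunctor.d₁_eq F G _ _ (i₁' := i + 1) rfl _ _ (by dsimp; lia),
    mapBifunctor.d₂_eq F G _ _ _ (i₂' := j + 1) rfl _ (by dsimp; lia)]
  simp

variable {F G}

/-- Morphisms out of a term of the tensor product which are supported on a single summand. -/
theorem exists_tensor_desc {A : C} (m n k : ℤ) (h : m + n = k) (f : F.X m ⊗ G.X n ⟶ A)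
    (hf : ∀ i, F.d i m ▷ G.X n ≫ f = 0) (hf' : ∀ j, F.X m ◁ G.d j n ≫ f = 0) :
    ∃ g : (tensorObj F G).X k ⟶ A, ιTensorObj F G m n k h ≫ g = f ∧
      (tensorObj F G).d (k - 1) k ≫ g = 0 ∧
      ∀ i j (hij : i + j = k), i ≠ m → ιTensorObj F G i j k hij ≫ g = 0 := by
  -- Zero on every other summand; `i = m` forces `j = n`. The differential reaches the summand `(m,
  -- n)` only from `(m - 1, n)` and `(m, n - 1)`, which `hf` and `hf'` handle.
  let g : (tensorObj F G).X k ⟶ A := mapBifunctorDesc fun i j (hij : i + j = k) =>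
    if hi : i = m then eqToHom (by
      obtain rfl : j = n := by lia
      rw [hi]; rfl) ≫ f else 0
  have hg : ιTensorObj F G m n k h ≫ g = f := by simp [g]
  have hg' : ∀ i j (hij : i + j = k), i ≠ m → ιTensorObj F G i j k hij ≫ g = 0 := by
    intro i j hij hi
    simp [g, hi]
  refine ⟨g, hg, ?_, hg'⟩
  apply mapBifunctor.hom_ext
  intro i j hij
  replace hij : i + j = k - 1 := hij
  rw [comp_zero]
  change ιTensorObj F G i j (k - 1) hij ≫ _ = 0
  rw [← Category.assoc, ι_tensor_d F G i j (k - 1) k hij (by lia), Preadditive.add_comp,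
    Linear.units_smul_comp, Category.assoc, Category.assoc]
  have h1 : F.d i (i + 1) ▷ G.X j ≫ ιTensorObj F G (i + 1) j k (by lia) ≫ g = 0 := by
    by_cases hi : i + 1 = m
    · obtain rfl : j = n := by lia
      subst hi
      rw [hg, hf]
    · rw [hg' _ _ _ hi, comp_zero]
  have h2 : F.X i ◁ G.d j (j + 1) ≫ ιTensorObj F G i (j + 1) k (by lia) ≫ g = 0 := by
    by_cases hi : i = m
    · obtain rfl : n = j + 1 := by lia
      subst hi
      rw [hg, hf']
    · rw [hg' _ _ _ hi, comp_zero]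
  rw [h1, h2, smul_zero, add_zero]

/-- The product of two cycles is a cycle. -/
theorem tensor_cycle_d (m n k k' : ℤ) (h : m + n = k) {A B : C} (z : A ⟶ F.X m) (w : B ⟶ G.X n)
    (hz : z ≫ F.d m (m + 1) = 0) (hw : w ≫ G.d n (n + 1) = 0) :
    ((z ⊗ₘ w) ≫ ιTensorObj F G m n k h) ≫ (tensorObj F G).d k k' = 0 := by
  by_cases hk : k + 1 = k'
  · rw [Category.assoc, ι_tensor_d F G m n k k' h hk, Preadditive.comp_add,
      Linear.comp_units_smul]
    have h1 : (z ⊗ₘ w) ≫ F.d m (m + 1) ▷ G.X n = 0 := by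
      rw [MonoidalCategory.tensorHom_def', Category.assoc, ← comp_whiskerRight, hz]
      simp
    have h2 : (z ⊗ₘ w) ≫ F.X m ◁ G.d n (n + 1) = 0 := by
      rw [MonoidalCategory.tensorHom_def, Category.assoc, ← MonoidalCategory.whiskerLeft_comp, hw]
      simp
    rw [reassoc_of% h1, reassoc_of% h2]
    simp
  · rw [(tensorObj F G).shape _ _ hk, comp_zero]

end TensorDifferential

/-! ### Support of a tensor product. -/

section TensorSupport

open HomologicalComplex

variable {R : Type u} [CommRing R]

theorem exists_comp_ne_zero {M N : FGModuleCat.{u} R} {f : M ⟶ N} (hf : f ≠ 0) :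
    ∃ z : 𝟙_ (FGModuleCat.{u} R) ⟶ M, z ≫ f ≠ 0 := by
  by_contra! h
  apply hf
  ext m
  have h1 := h (FGModuleCat.ofHom (LinearMap.toSpanSingleton R M m))
  have h2 : f.hom.hom ((1 : R) • m) = 0 :=
    DFunLike.congr_fun (congr_arg (fun f => f.hom.hom) h1) (1 : R)
  rw [one_smul] at h2
  exact h2

theorem eq_zero_of_apply_one {M : FGModuleCat.{u} R} {f : 𝟙_ (FGModuleCat.{u} R) ⟶ M}
    (h : f.hom.hom (1 : R) = 0) : f = 0 := by
  refine FGModuleCat.hom_ext (LinearMap.ext fun (r : R) => ?_)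
  have h1 : f.hom.hom (r • (1 : R)) = r • f.hom.hom (1 : R) := f.hom.hom.map_smul r (1 : R)
  rw [h, smul_zero, smul_eq_mul, mul_one] at h1
  exact h1

theorem smul_ne_zero_of_notMem {p : PrimeSpectrum R} {s : R} (hs : s ∉ p.asIdeal)
    {M : FGModuleCat.{u} R} {f : M ⟶ FGModuleCat.of R (R ⧸ p.asIdeal)} (hf : f ≠ 0) :
    s • f ≠ 0 := by
  intro h
  apply hf
  ext m
  have h1 : s • (f.hom.hom m : R ⧸ p.asIdeal) = 0 :=
    DFunLike.congr_fun (congr_arg (fun f => f.hom.hom) h) m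
  rw [Algebra.smul_def, mul_eq_zero] at h1
  exact h1.resolve_left fun h => hs (Ideal.Quotient.eq_zero_iff_mem.1 h)

/-- A finitely generated module whose support contains `p` has a nonzero map to `R ⧸ p`. -/
theorem exists_hom_quotient_ne_zero {M : FGModuleCat.{u} R} {p : PrimeSpectrum R}
    (hp : p ∈ Module.support R M) : ∃ f : M ⟶ FGModuleCat.of R (R ⧸ p.asIdeal), f ≠ 0 := by
  let κ := p.asIdeal.ResidueField
  have : Nontrivial (TensorProduct R κ M) :=
    (Module.mem_support_iff_nontrivial_residueField_tensorProduct p).1 hp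
  obtain ⟨x, hx⟩ := exists_ne (0 : TensorProduct R κ M)
  obtain ⟨l, hl⟩ : ∃ l : Module.Dual κ (TensorProduct R κ M), l x ≠ 0 := by
    by_contra! h
    exact hx ((Module.forall_dual_apply_eq_zero_iff κ x).1 h)
  let f : M →ₗ[R] κ := l.restrictScalars R ∘ₗ TensorProduct.mk R κ M 1
  have hf : ∃ m, f m ≠ 0 := by
    by_contra! h
    apply hl
    clear hl hx
    induction x with
    | zero => simp
    | add x y hx hy => rw [map_add, hx, hy, add_zero]
    | tmul a m =>
      have : a ⊗ₜ[R] m = a • ((1 : κ) ⊗ₜ[R] m) := by simp [TensorProduct.smul_tmul']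
      rw [this, map_smul]
      exact (congr_arg (a • ·) (h m)).trans (smul_zero a)
  obtain ⟨m, hm⟩ := hf
  obtain ⟨S, hS⟩ := (inferInstance : Module.Finite R M).fg_top
  classical
  -- A functional on the fibre at `p` gives a nonzero map to the residue field; a common denominator
  -- for its values on finitely many generators brings it into `R ⧸ p`.
  obtain ⟨b, hb⟩ := IsLocalization.exist_integer_multiples_of_finset
    (nonZeroDivisors (R ⧸ p.asIdeal)) (S.image f)
  let i : (R ⧸ p.asIdeal) →ₗ[R] κ := (Algebra.linearMap (R ⧸ p.asIdeal) κ).restrictScalars R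
  have hi : Function.Injective i := IsFractionRing.injective (R ⧸ p.asIdeal) κ
  let f' : M →ₗ[R] κ := (LinearMap.mulLeft R (algebraMap (R ⧸ p.asIdeal) κ b)) ∘ₗ f
  have hf' : ∀ m, f' m ∈ LinearMap.range i := by
    have h : Submodule.span R (S : Set M) ≤ (LinearMap.range i).comap f' := by
      rw [Submodule.span_le]
      intro m hm
      obtain ⟨r, hr⟩ := hb (f m) (Finset.mem_image_of_mem f hm)
      exact ⟨r, hr.trans (Algebra.smul_def _ _)⟩
    intro m
    exact h (hS ▸ Submodule.mem_top)
  refine ⟨FGModuleCat.ofHom ((LinearEquiv.ofInjective i hi).symm.toLinearMap ∘ₗ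
    f'.codRestrict (LinearMap.range i) hf'), fun h => ?_⟩
  have h1 : (LinearEquiv.ofInjective i hi).symm (f'.codRestrict (LinearMap.range i) hf' m) = 0 :=
    DFunLike.congr_fun (congr_arg (fun f => f.hom.hom) h) m
  rw [LinearEquiv.map_eq_zero_iff] at h1
  have h2 : algebraMap (R ⧸ p.asIdeal) κ b * f m = 0 := congr_arg Subtype.val h1
  refine (mul_eq_zero.1 h2).elim (fun h => ?_) hm
  exact nonZeroDivisors.ne_zero b.2 ((FaithfulSMul.algebraMap_eq_zero_iff _ _).1 h)

theorem tensorHom_smul_right (F G : CochainComplex (FGModuleCat.{u} R) ℤ) [HasTensor F G] (s : R) :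
    HomologicalComplex.tensorHom (𝟙 F) (s • 𝟙 G) = s • 𝟙 (tensorObj F G) := by
  apply HomologicalComplex.hom_ext
  intro n
  apply mapBifunctor.hom_ext
  intro i j hij
  simp

variable [IsNoetherianRing R]

/-- Detection of the support of the homology by cycles and functionals. -/
theorem mem_support_homology {K : CochainComplex (FGModuleCat.{u} R) ℤ} {n : ℤ}
    {p : PrimeSpectrum R} {T : FGModuleCat.{u} R} (z : T ⟶ K.X n)
    (l : K.X n ⟶ FGModuleCat.of R (R ⧸ p.asIdeal)) (hz : z ≫ K.d n (n + 1) = 0)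
    (hl : K.d (n - 1) n ≫ l = 0) (hzl : z ≫ l ≠ 0) : p ∈ Module.support R (K.homology n) := by
  by_contra h
  obtain ⟨s, hs, hs0⟩ := (notMem_support_iff_exists_smul_id _ _).1 h
  apply smul_ne_zero_of_notMem hs hzl
  -- On cycles `l` factors through homology, so a scalar killing the homology would kill `z ≫ l`.
  obtain ⟨g, hg⟩ : ∃ g, K.homologyπ n ≫ g = K.iCycles n ≫ l :=
    ⟨(K.homologyIsCokernel (n - 1) n (by simp)).desc (CokernelCofork.ofπ (K.iCycles n ≫ l)
      (by simp [hl])), (K.homologyIsCokernel (n - 1) n (by simp)).fac _ WalkingParallelPair.one⟩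
  rw [← K.liftCycles_i z (n + 1) (by simp) hz, Category.assoc, ← hg, ← Linear.comp_smul,
    ← Linear.comp_smul, ← Category.id_comp g, ← Linear.smul_comp, hs0]
  simp

theorem homologyMap_smul_id (K : CochainComplex (FGModuleCat.{u} R) ℤ) (n : ℤ) (s : R) :
    HomologicalComplex.homologyMap (s • 𝟙 K) n = s • 𝟙 (K.homology n) := by
  have h : HomologicalComplex.cyclesMap (s • 𝟙 K) n = s • 𝟙 (K.cycles n) := by
    rw [← cancel_mono (K.iCycles n)]
    simp
  rw [← cancel_epi (K.homologyπ n), HomologicalComplex.homologyπ_naturality, h]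
  simp

/-- The top degree in which the homology of a bounded above complex is supported at `p`. -/
theorem exists_top_support_homology (F : CochainComplex (FGModuleCat.{u} R) ℤ) (b : ℤ)
    [F.IsStrictlyLE b] (p : PrimeSpectrum R) (k : ℤ) (hk : p ∈ Module.support R (F.homology k)) :
    ∃ n, p ∈ Module.support R (F.homology n) ∧
      ∀ i, n < i → p ∉ Module.support R (F.homology i) := by
  obtain ⟨n, hn, hmax⟩ := Int.exists_greatest_of_bdd
    (P := fun i => p ∈ Module.support R (F.homology i)) ⟨b, fun i hi => by
      by_contra! hbi
      refine (notMem_support_iff_exists_smul_id _ p).2 ⟨1, ?_, ?_⟩ hi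
      · exact (Ideal.ne_top_iff_one _).1 p.2.ne_top
      · refine IsZero.eq_of_src ?_ _ _
        exact ((F.exactAt_of_isLE b i hbi).isZero_homology)⟩ ⟨k, hk⟩
  exact ⟨n, hn, fun i hi h => (hmax i h).not_gt hi⟩

/-- If `n` is the top degree in which the homology of a bounded above complex of projectives is
supported at `p`, then there are a cycle and a functional killing boundaries in degree `n` which
pair to something nonzero modulo `p`. -/
theorem exists_cycle_functional (F : CochainComplex (FGModuleCat.{u} R) ℤ)
    [∀ i, Projective (F.X i)] (b : ℤ) [F.IsStrictlyLE b] (p : PrimeSpectrum R) (n : ℤ)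
    (hn : p ∈ Module.support R (F.homology n))
    (hmax : ∀ i, n < i → p ∉ Module.support R (F.homology i)) :
    ∃ (z : 𝟙_ (FGModuleCat.{u} R) ⟶ F.X n)
      (l : F.X n ⟶ FGModuleCat.of R (R ⧸ p.asIdeal)),
      z ≫ F.d n (n + 1) = 0 ∧ (∀ i, F.d i n ≫ l = 0) ∧ z ≫ l ≠ 0 := by
  obtain ⟨s, hs, φ, ⟨H⟩, hφ⟩ := exists_homotopy_smul F b p (n + 1) fun i hi => hmax i hi
  obtain ⟨μ, hμ⟩ := exists_hom_quotient_ne_zero hn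
  have hd : φ.f n ≫ F.d n (n + 1) = 0 := by rw [φ.comm, hφ _ le_rfl, comp_zero]
  -- `φ` vanishes in degree `n + 1`, so in degree `n` it lands in cycles. This extends `s • μ` from
  -- the cycles to all of `F.X n`.
  let l := F.liftCycles (φ.f n) (n + 1) (by simp) hd ≫ F.homologyπ n ≫ μ
  have hl : F.iCycles n ≫ l = F.homologyπ n ≫ (s • μ) := by
    have h1 : F.iCycles n ≫ F.liftCycles (φ.f n) (n + 1) (by simp) hd =
        HomologicalComplex.cyclesMap φ n := by
      rw [← cancel_mono (F.iCycles n)]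
      simp
    have h2 : HomologicalComplex.homologyMap φ n = s • 𝟙 _ := by
      rw [H.homologyMap_eq, homologyMap_smul_id]
    rw [reassoc_of% h1, ← HomologicalComplex.homologyπ_naturality_assoc, h2]
    simp
  have hl0 : F.iCycles n ≫ l ≠ 0 := by
    rw [hl]
    intro h
    exact smul_ne_zero_of_notMem hs hμ ((cancel_epi (F.homologyπ n)).1 (by simpa using h))
  obtain ⟨z, hz⟩ := exists_comp_ne_zero hl0
  refine ⟨z ≫ F.iCycles n, l, by simp, fun i => ?_, by simpa using hz⟩
  have h1 : F.d i n ≫ F.liftCycles (φ.f n) (n + 1) (by simp) hd = φ.f i ≫ F.toCycles i n := by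
    rw [← cancel_mono (F.iCycles n)]
    simp
  rw [reassoc_of% h1]
  simp

/-- On homology in degree `n` the map `φ` induces both `s` and zero. -/
theorem notMem_support_of_homotopy (K : CochainComplex (FGModuleCat.{u} R) ℤ) (n : ℤ) (s : R)
    (p : PrimeSpectrum R) (hs : s ∉ p.asIdeal) (φ : K ⟶ K) (H : Homotopy φ (s • 𝟙 K))
    (hφ : φ.f n = 0) : p ∉ Module.support R (K.homology n) := by
  refine (notMem_support_iff_exists_smul_id _ p).2 ⟨s, hs, ?_⟩
  rw [← homologyMap_smul_id, ← H.homologyMap_eq, ← cancel_epi (K.homologyπ n),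
    HomologicalComplex.homologyπ_naturality]
  have : HomologicalComplex.cyclesMap φ n = 0 := by
    rw [← cancel_mono (K.iCycles n)]
    simp [hφ]
  simp [this]

theorem notMem_support_tensor (F G : CochainComplex (FGModuleCat.{u} R) ℤ)
    [∀ i, Projective (G.X i)] (a b : ℤ) [F.IsStrictlyLE a] [G.IsStrictlyLE b] [HasTensor F G]
    (p : PrimeSpectrum R) (hp : ∀ i, p ∉ Module.support R (G.homology i)) (n : ℤ) :
    p ∉ Module.support R ((tensorObj F G).homology n) := by
  -- Because `F` vanishes above degree `a`, only the terms of `G` in degrees at least `n - a`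
  -- contribute to degree `n`.
  obtain ⟨s, hs, φ, ⟨H⟩, hφ⟩ := exists_homotopy_smul G b p (n - a) fun i _ => hp i
  refine notMem_support_of_homotopy _ n s p hs (HomologicalComplex.tensorHom (𝟙 F) φ)
    ((mapBifunctorMapHomotopy₂ (𝟙 F) H _ _).trans (Homotopy.ofEq (tensorHom_smul_right F G s))) ?_
  apply mapBifunctor.hom_ext
  intro i j hij
  replace hij : i + j = n := hij
  by_cases hj : n - a ≤ j
  · simp [hφ j hj]
  · exact ((tensorRight (G.X j)).map_isZero (F.isZero_of_isStrictlyLE a i (by lia))).eq_of_src _ _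

/-- A Künneth argument in top degrees: the product of the two cycles pairs with the product of the
two functionals to a product of nonzero elements of the domain `R ⧸ p`. -/
theorem mem_support_tensor (F G : CochainComplex (FGModuleCat.{u} R) ℤ)
    [∀ i, Projective (F.X i)] [∀ i, Projective (G.X i)] (a b : ℤ) [F.IsStrictlyLE a]
    [G.IsStrictlyLE b] [HasTensor F G] (p : PrimeSpectrum R) (i j : ℤ)
    (hF : p ∈ Module.support R (F.homology i)) (hG : p ∈ Module.support R (G.homology j)) :
    ∃ n, p ∈ Module.support R ((tensorObj F G).homology n) := by
  obtain ⟨m, hm, hm'⟩ := exists_top_support_homology F a p i hF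
  obtain ⟨n, hn, hn'⟩ := exists_top_support_homology G b p j hG
  obtain ⟨z, l, hz, hl, hzl⟩ := exists_cycle_functional F a p m hm hm'
  obtain ⟨w, μ, hw, hμ, hwμ⟩ := exists_cycle_functional G b p n hn hn'
  let A := FGModuleCat.of R (R ⧸ p.asIdeal)
  let mul : A ⊗ A ⟶ A := FGModuleCat.ofHom (LinearMap.mul' R (R ⧸ p.asIdeal))
  obtain ⟨g, hg, hdg, -⟩ := exists_tensor_desc (F := F) (G := G) m n (m + n) rfl ((l ⊗ₘ μ) ≫ mul)
    (fun i => by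
      rw [MonoidalCategory.tensorHom_def, Category.assoc, ← comp_whiskerRight_assoc, hl]
      simp)
    (fun j => by
      rw [MonoidalCategory.tensorHom_def', Category.assoc,
        ← whiskerLeft_comp_assoc, hμ]
      simp)
  refine ⟨m + n, mem_support_homology _ g (tensor_cycle_d m n (m + n) _ rfl z w hz hw) hdg ?_⟩
  rw [Category.assoc, hg, tensorHom_comp_tensorHom_assoc]
  intro h
  have h1 : (z ≫ l).hom.hom (1 : R) * (w ≫ μ).hom.hom (1 : R) = (0 : R ⧸ p.asIdeal) :=
    DFunLike.congr_fun (congr_arg (fun f => f.hom.hom) h) ((1 : R) ⊗ₜ[R] (1 : R))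
  rcases mul_eq_zero.1 h1 with h | h
  · exact hzl (eq_zero_of_apply_one h)
  · exact hwμ (eq_zero_of_apply_one h)

end TensorSupport

/-! ### Supports in `D⁻` and the primes of locally acyclic complexes. -/

section Support

variable {R : Type u} [CommRing R] [IsNoetherianRing R]

theorem mem_supp_iff {X : DMinus R} {p : PrimeSpectrum R} :
    p ∈ supp X ↔ ∃ n, p ∈ Module.support R (cohomology X n) := by
  simp [supp]

theorem supp_eq_of_obj_iso {X Y : DMinus R} (e : X.obj ≅ Y.obj) : supp X = supp Y := by
  ext p
  simp only [mem_supp_iff]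
  exact exists_congr fun n =>
    by rw [support_eq_of_iso ((DerivedCategory.homologyFunctor _ n).mapIso e)]

theorem support_homology_eq_of_iso {X : DMinus R} {K : CochainComplex (FGModuleCat.{u} R) ℤ}
    (e : DerivedCategory.Q.obj K ≅ X.obj) (n : ℤ) :
    Module.support R (K.homology n) = Module.support R (cohomology X n) :=
  support_eq_of_iso (((DerivedCategory.homologyFunctorFactors _ n).app K).symm ≪≫
    (DerivedCategory.homologyFunctor _ n).mapIso e)

theorem mem_supp_iff_of_iso {X : DMinus R} {K : CochainComplex (FGModuleCat.{u} R) ℤ}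
    (e : DerivedCategory.Q.obj K ≅ X.obj) {p : PrimeSpectrum R} :
    p ∈ supp X ↔ ∃ n, p ∈ Module.support R (K.homology n) := by
  rw [mem_supp_iff]
  exact exists_congr fun n => by rw [support_homology_eq_of_iso e]

theorem supp_retract {X Y : DMinus R} (h : Retract X Y) : supp X ⊆ supp Y := by
  intro p hp
  obtain ⟨n, hn⟩ := mem_supp_iff.1 hp
  refine mem_supp_iff.2 ⟨n, ?_⟩
  by_contra hY
  obtain ⟨s, hs, hs0⟩ := (notMem_support_iff_exists_smul_id _ _).1 hY
  refine (notMem_support_iff_exists_smul_id _ _).2 ⟨s, hs, ?_⟩ hn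
  let h' := h.map (DerivedCategory.Minus.ι ⋙ DerivedCategory.homologyFunctor _ n)
  have h1 : h'.i ≫ (s • 𝟙 _) ≫ h'.r = s • 𝟙 _ := by
    rw [Linear.smul_comp, Linear.comp_smul, Category.id_comp, h'.retract]
  exact h1.symm.trans ((congr_arg (fun f => h'.i ≫ f ≫ h'.r) hs0).trans (by simp))

theorem notMem_support_of_exact {S : ShortComplex (FGModuleCat.{u} R)} (hS : S.Exact)
    {p : PrimeSpectrum R} (h₁ : p ∉ Module.support R S.X₁) (h₃ : p ∉ Module.support R S.X₃) :
    p ∉ Module.support R S.X₂ := by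
  obtain ⟨s, hs, hs0⟩ := (notMem_support_iff_exists_smul_id _ _).1 h₁
  obtain ⟨t, ht, ht0⟩ := (notMem_support_iff_exists_smul_id _ _).1 h₃
  refine (notMem_support_iff_exists_smul_id _ _).2
    ⟨s * t, fun hst => (p.2.mem_or_mem hst).elim hs ht, ?_⟩
  -- Multiplication by `t` pushes `S.X₂` into the image of `S.X₁`, at least after an epimorphism
  -- `π`, and `s` kills that image.
  obtain ⟨A, π, _, x, hx⟩ := hS.exact_up_to_refinements (t • 𝟙 S.X₂) (by
    rw [Linear.smul_comp, Category.id_comp, ← Category.comp_id S.g, ← Linear.comp_smul, ht0,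
      comp_zero])
  rw [← cancel_epi π, mul_smul, Linear.comp_smul, hx, ← Category.comp_id x, Category.assoc,
    ← Linear.comp_smul, ← Linear.smul_comp, hs0]
  simp

theorem notMem_supp_of_distTriang {T : Pretriangulated.Triangle (DMinus R)}
    (hT : T ∈ Pretriangulated.distinguishedTriangles) {p : PrimeSpectrum R}
    (h₁ : p ∉ supp T.obj₁) (h₃ : p ∉ supp T.obj₃) : p ∉ supp T.obj₂ := by
  simp only [mem_supp_iff, not_exists] at h₁ h₃ ⊢
  intro n
  exact notMem_support_of_exact (DerivedCategory.HomologySequence.exact₂ _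
    (DerivedCategory.Minus.ι.map_distinguished T hT) n) (h₁ n) (h₃ n)

/-- The cohomology of a shifted complex. -/
theorem support_cohomology_shift (X : DMinus R) (a n : ℤ) :
    Module.support R (cohomology (X⟦a⟧) n) = Module.support R (cohomology X (a + n)) :=
  support_eq_of_iso ((DerivedCategory.homologyFunctor (FGModuleCat.{u} R) n).mapIso
    ((DerivedCategory.Minus.ι.commShiftIso a).app X) ≪≫
      ((DerivedCategory.homologyFunctor (FGModuleCat.{u} R) 0).shiftIso a n (a + n) rfl).app X.obj)

theorem supp_shift (X : DMinus R) (a : ℤ) : supp (X⟦a⟧) = supp X := by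
  ext p
  simp only [mem_supp_iff, support_cohomology_shift]
  exact ⟨fun ⟨n, hn⟩ => ⟨_, hn⟩, fun ⟨n, hn⟩ => ⟨n - a, by rwa [add_sub_cancel]⟩⟩

theorem supp_of_isZero {X : DMinus R} (hX : IsZero X) : supp X = ∅ := by
  ext p
  simp only [mem_supp_iff, Set.mem_empty_iff_false, iff_false, not_exists]
  intro n
  refine (notMem_support_iff_exists_smul_id _ _).2
    ⟨1, (Ideal.ne_top_iff_one _).1 p.2.ne_top, IsZero.eq_of_src ?_ _ _⟩
  exact (DerivedCategory.Minus.ι ⋙ DerivedCategory.homologyFunctor _ n).map_isZero hX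

/-- A finitely generated module, as a complex concentrated in degree zero. -/
noncomputable def ofModule (M : FGModuleCat.{u} R) : DMinus R :=
  ⟨(DerivedCategory.singleFunctor _ 0).obj M, 0, inferInstance⟩

theorem supp_ofModule (M : FGModuleCat.{u} R) : supp (ofModule M) = Module.support R M := by
  ext p
  rw [mem_supp_iff_of_iso (X := ofModule M)
    ((DerivedCategory.singleFunctorIsoCompQ _ 0).symm.app M)]
  have h0 : Module.support R (((HomologicalComplex.single _ (ComplexShape.up ℤ) 0).obj M).homology 0) =
      Module.support R M :=
    support_eq_of_iso (HomologicalComplex.singleObjHomologySelfIso _ 0 M)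
  refine ⟨fun ⟨n, hn⟩ => ?_, fun h => ⟨0, h0.ge h⟩⟩
  by_cases hn0 : n = 0
  · subst hn0
    exact h0.le hn
  · refine ((notMem_support_iff_exists_smul_id _ p).2
      ⟨1, (Ideal.ne_top_iff_one _).1 p.2.ne_top, IsZero.eq_of_src ?_ _ _⟩ hn).elim
    exact HomologicalComplex.isZero_single_obj_homology _ 0 M n hn0

/-- The class of complexes which vanish locally at `p`. -/
def localAcyclic (p : PrimeSpectrum R) : ObjectProperty (DMinus R) := fun X => p ∉ supp X

instance (p : PrimeSpectrum R) : (localAcyclic p).IsStableUnderRetracts where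
  of_retract h hY hX := hY (supp_retract h hX)

instance (p : PrimeSpectrum R) : (localAcyclic p).IsTriangulated where
  exists_zero := ⟨_, isZero_zero _, by
    simp only [localAcyclic, supp_of_isZero (isZero_zero (DMinus R)), Set.mem_empty_iff_false,
      not_false_eq_true]⟩
  isStableUnderShiftBy a := ⟨fun X hX => by
    change p ∉ supp (X⟦a⟧)
    rwa [supp_shift]⟩
  ext₂' T hT h₁ h₃ := ObjectProperty.le_isoClosure _ _ (notMem_supp_of_distTriang hT h₁ h₃)

theorem isPrimeThickTensorIdeal_localAcyclic (p : PrimeSpectrum R) :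
    IsPrimeThickTensorIdeal derivedTensor (localAcyclic p) where
  isTriangulated := inferInstance
  isStableUnderRetracts := inferInstance
  tensor_mem X Y hY := by
    intro h
    obtain ⟨n, hn⟩ := (mem_supp_iff_of_iso (X := derivedTensor X Y) (Iso.refl _)).1 h
    refine notMem_support_tensor _ _ (ProjRes.nonempty X).some.bound
      (ProjRes.nonempty Y).some.bound p (fun i hi => hY ?_) n hn
    exact (mem_supp_iff_of_iso (ProjRes.nonempty Y).some.iso).2 ⟨i, hi⟩
  proper := ⟨ofModule (FGModuleCat.of R R), by
    simp only [localAcyclic, not_not, supp_ofModule]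
    rw [Module.mem_support_iff_of_finite]
    intro r hr
    rw [Module.mem_annihilator] at hr
    simp [show r = 0 by simpa using hr (1 : R)]⟩
  mem_or_mem X Y h := by
    by_contra! hXY
    simp only [localAcyclic, not_not] at hXY
    obtain ⟨i, hi⟩ := (mem_supp_iff_of_iso (ProjRes.nonempty X).some.iso).1 hXY.1
    obtain ⟨j, hj⟩ := (mem_supp_iff_of_iso (ProjRes.nonempty Y).some.iso).1 hXY.2
    obtain ⟨n, hn⟩ := mem_support_tensor _ _ (ProjRes.nonempty X).some.bound
      (ProjRes.nonempty Y).some.bound p i j hi hj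
    exact h ((mem_supp_iff_of_iso (X := derivedTensor X Y) (Iso.refl _)).2 ⟨n, hn⟩)

end Support

/-! ### Passing triangles between `D⁻` and the derived category. -/

section Triangles

open Pretriangulated

variable {R : Type u} [CommRing R] [IsNoetherianRing R]

/-- Distinguished triangles of the derived category with objects in `D⁻` lift to `D⁻`. -/
theorem exists_distTriang_minus {X Y Z : DMinus R} (f : X ⟶ Y)
    {g : Y.obj ⟶ Z.obj} {h : Z.obj ⟶ X.obj⟦(1 : ℤ)⟧}
    (hT : Triangle.mk f.hom g h ∈ distTriang _) :
    ∃ (g' : Y ⟶ Z) (h' : Z ⟶ X⟦(1 : ℤ)⟧), Triangle.mk f g' h' ∈ distTriang _ := by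
  obtain ⟨g', rfl⟩ := DerivedCategory.Minus.ι.map_surjective (X := Y) (Y := Z) g
  obtain ⟨h', hh'⟩ := DerivedCategory.Minus.ι.map_surjective (X := Z) (Y := X⟦(1 : ℤ)⟧)
    (h ≫ (DerivedCategory.Minus.ι.commShiftIso (1 : ℤ)).inv.app X)
  refine ⟨g', h', isomorphic_distinguished _ hT _ ?_⟩
  refine Triangle.isoMk _ _ (Iso.refl _) (Iso.refl _) (Iso.refl _)
    ((Category.comp_id _).trans (Category.id_comp _).symm)
    ((Category.comp_id _).trans (Category.id_comp _).symm) ?_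
  refine (congr_arg (_ ≫ ·) (CategoryTheory.Functor.map_id _ _)).trans
    ((Category.comp_id _).trans (Eq.trans ?_ (Category.id_comp _).symm))
  change DerivedCategory.Minus.ι.map h' ≫
    (DerivedCategory.Minus.ι.commShiftIso (1 : ℤ)).hom.app X = h
  rw [hh', Category.assoc, Iso.inv_hom_id_app]
  exact Category.comp_id _

variable {P : ObjectProperty (DMinus R)} [P.IsTriangulated] [P.IsStableUnderRetracts]

theorem prop_mid_of_distTriang {X Y Z : DMinus R} {f : X.obj ⟶ Y.obj} {g : Y.obj ⟶ Z.obj}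
    {h : Z.obj ⟶ X.obj⟦(1 : ℤ)⟧} (hT : Triangle.mk f g h ∈ distTriang _) (hX : P X) (hZ : P Z) :
    P Y := by
  obtain ⟨f, rfl⟩ := DerivedCategory.Minus.ι.map_surjective (X := X) (Y := Y) f
  obtain ⟨g', h', hT'⟩ := exists_distTriang_minus f hT
  exact P.ext_of_isTriangulatedClosed₂ _ hT' hX hZ

end Triangles

/-! ### Retract and octahedral arguments. -/

section TriangulatedClosure

open Pretriangulated

variable {T : Type u} [Category.{v} T] [HasZeroObject T] [HasShift T ℤ] [Preadditive T]
  [∀ n : ℤ, (shiftFunctor T n).Additive] [Pretriangulated T]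
  {P : ObjectProperty T} [P.IsStableUnderRetracts]

/-- If the cone of the zero map `X ⟶ Y` is in `P`, then so is `Y`. -/
theorem prop_of_cone_zero {X Y Z : T} {g : Y ⟶ Z} {h : Z ⟶ X⟦(1 : ℤ)⟧}
    (hT : Triangle.mk (0 : X ⟶ Y) g h ∈ distTriang _) (hZ : P Z) : P Y := by
  -- The identity of `Y` kills the zero map, so it factors through `g`: `Y` is a retract of `Z`.
  obtain ⟨r, hr⟩ := Triangle.yoneda_exact₂ _ hT (𝟙 Y) zero_comp
  exact P.prop_of_retract ⟨g, r, hr.symm⟩ hZ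

/-- If an endomorphism of `A` factors through an object of `P` and its cone is in `P`, then `A` is
in `P`. -/
theorem prop_of_factor [P.IsTriangulated] [IsTriangulated T] {A Z C : T} (f : A ⟶ Z) (g : Z ⟶ A) {c : A ⟶ C}
    {h : C ⟶ A⟦(1 : ℤ)⟧} (hT : Triangle.mk (f ≫ g) c h ∈ distTriang _) (hZ : P Z) (hC : P C) :
    P A := by
  obtain ⟨D, d, d', hD⟩ := distinguished_cocone_triangle g
  have hgd : g ≫ d = 0 := comp_distTriang_mor_zero₁₂ _ hD
  obtain ⟨W, w, w', hW⟩ := distinguished_cocone_triangle (0 : A ⟶ D)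
  have h0 : (f ≫ g) ≫ d = 0 := by rw [Category.assoc, hgd, comp_zero]
  -- The composite of `f ≫ g` with `d` is zero, and its cone `W` is an extension of `Z⟦1⟧` by `C`.
  -- So `W` is in `P`, hence so is its retract `D`, and then `A`, an extension of `D` by `Z`.
  have o := Triangulated.someOctahedron h0 hT (rot_of_distTriang _ hD) hW
  have hWP : P W := P.ext_of_isTriangulatedClosed₂ _ o.mem hC (P.le_shift (1 : ℤ) _ hZ)
  exact P.ext_of_isTriangulatedClosed₂ _ hD hZ (prop_of_cone_zero hW hWP)

end TriangulatedClosure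

/-! ### Dévissage of bounded complexes to the modules `R ⧸ q`. -/

section Devissage

open Pretriangulated

variable {R : Type u} [CommRing R]

theorem notMem_support_of_isZero {M : FGModuleCat.{u} R} (hM : IsZero M) (p : PrimeSpectrum R) :
    p ∉ Module.support R M :=
  (notMem_support_iff_exists_smul_id _ _).2
    ⟨1, (Ideal.ne_top_iff_one _).1 p.2.ne_top, hM.eq_of_src _ _⟩

variable [IsNoetherianRing R]

/-- A module homomorphism, as a morphism of complexes concentrated in degree zero. -/
noncomputable def ofModuleMap {M N : FGModuleCat.{u} R} (f : M ⟶ N) : ofModule M ⟶ ofModule N :=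
  ObjectProperty.homMk ((DerivedCategory.singleFunctor _ 0).map f)

@[simp]
theorem ofModuleMap_id (M : FGModuleCat.{u} R) : ofModuleMap (𝟙 M) = 𝟙 (ofModule M) :=
  DerivedCategory.Minus.ι.map_injective ((DerivedCategory.singleFunctor _ 0).map_id M)

@[simp]
theorem ofModuleMap_comp {M N K : FGModuleCat.{u} R} (f : M ⟶ N) (g : N ⟶ K) :
    ofModuleMap f ≫ ofModuleMap g = ofModuleMap (f ≫ g) :=
  DerivedCategory.Minus.ι.map_injective ((DerivedCategory.singleFunctor _ 0).map_comp f g).symm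

theorem exists_distTriang_ofModule {S : ShortComplex (FGModuleCat.{u} R)} (hS : S.ShortExact) :
    ∃ (g : ofModule S.X₂ ⟶ ofModule S.X₃) (h : ofModule S.X₃ ⟶ (ofModule S.X₁)⟦(1 : ℤ)⟧),
      Triangle.mk (ofModuleMap S.f) g h ∈ distTriang _ :=
  exists_distTriang_minus (X := ofModule S.X₁) (Y := ofModule S.X₂) (Z := ofModule S.X₃) _
    hS.singleTriangle_distinguished

variable {P : ObjectProperty (DMinus R)} [P.IsStableUnderRetracts]

/-- The cyclic module `R ⧸ I` as a complex. -/
noncomputable abbrev ofQuotient (I : Ideal R) : DMinus R := ofModule (FGModuleCat.of R (R ⧸ I))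

theorem prop_ofModule_of_iso {M N : FGModuleCat.{u} R} (e : M ≅ N) (h : P (ofModule M)) :
    P (ofModule N) :=
  P.prop_of_iso ⟨ofModuleMap e.hom, ofModuleMap e.inv, by simp, by simp⟩ h

variable [P.IsTriangulated]

/-- Induction along short exact sequences, down to modules `R ⧸ q`; both outer terms have support
inside that of the middle one. -/
theorem prop_ofModule (M : FGModuleCat.{u} R)
    (hM : ∀ q ∈ Module.support R M, P (ofQuotient q.asIdeal)) : P (ofModule M) := by
  have key : (∀ q ∈ Module.support R M, P (ofQuotient q.asIdeal)) →
      P (ofModule (FGModuleCat.of R M)) := by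
    refine IsNoetherianRing.induction_on_isQuotientEquivQuotientPrime R
      (inferInstance : Module.Finite R M)
      (motive := fun N _ _ _ => (∀ q ∈ Module.support R N, P (ofQuotient q.asIdeal)) →
        P (ofModule (FGModuleCat.of R N))) ?_ ?_ ?_
    · intro N _ _ _ _ _
      have hN : IsZero (FGModuleCat.of R N) := by
        rw [IsZero.iff_id_eq_zero]
        ext x
        exact Subsingleton.elim (α := N) _ _
      refine P.prop_of_isZero ?_
      rw [IsZero.iff_id_eq_zero]
      have := ((DerivedCategory.singleFunctor (FGModuleCat.{u} R) 0).map_isZero hN)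
      exact DerivedCategory.Minus.ι.map_injective (this.eq_of_src _ _)
    · intro N _ _ _ p e h
      refine prop_ofModule_of_iso e.symm.toFGModuleCatIso (h p ?_)
      rw [e.support_eq, Module.mem_support_iff_of_finite, Ideal.annihilator_quotient]
    · intro N₁ _ _ _ N₂ _ _ _ N₃ _ _ _ f g hf hg hfg h₁ h₃ h
      rw [Module.support_of_exact hfg hf hg] at h
      let S : ShortComplex (FGModuleCat.{u} R) :=
        ShortComplex.mk (FGModuleCat.ofHom f) (FGModuleCat.ofHom g) (by
          ext x
          exact hfg.apply_apply_eq_zero x)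
      have hS : S.ShortExact := by
        have : Mono S.f := (forget₂ (FGModuleCat.{u} R) (ModuleCat.{u} R)).mono_of_mono_map
          ((ModuleCat.mono_iff_injective _).2 hf)
        have : Epi S.g := (forget₂ (FGModuleCat.{u} R) (ModuleCat.{u} R)).epi_of_epi_map
          ((ModuleCat.epi_iff_surjective _).2 hg)
        exact ⟨(S.exact_map_iff_of_faithful (forget₂ (FGModuleCat.{u} R) (ModuleCat.{u} R))).1
          ((ShortComplex.moduleCat_exact_iff _).2 fun x hx => (hfg x).1 hx)⟩
      obtain ⟨g', h', hT⟩ := exists_distTriang_ofModule hS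
      exact P.ext_of_isTriangulatedClosed₂ _ hT (h₁ fun q hq => h q (Or.inl hq))
        (h₃ fun q hq => h q (Or.inr hq))
  exact key hM

open DerivedCategory.TStructure in
-- Induction on the number `n` of degrees allowed to carry cohomology: truncation splits off the
-- lowest one, a shifted module, and the long exact sequence keeps the supports of both truncations
-- inside `supp X`.
theorem prop_of_isGE_of_isLE (n : ℕ) (a : ℤ) (X : DMinus R)
    (hGE : X.obj.IsGE a) (hLE : X.obj.IsLE (a + n - 1))
    (hX : ∀ q ∈ supp X, P (ofQuotient q.asIdeal)) : P X := by
  induction n generalizing a X with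
  | zero =>
    refine P.prop_of_isZero ?_
    rw [IsZero.iff_id_eq_zero]
    exact DerivedCategory.Minus.ι.map_injective
      ((t.isZero X.obj (a + (0 : ℕ) - 1) a (by simp)).eq_of_src _ _)
  | succ n ih =>
    have hLE' : t.IsLE X.obj (a + n) := by
      have := hLE
      rwa [show a + ((n + 1 : ℕ) : ℤ) - 1 = a + n by push_cast; ring] at this
    let A : DMinus R := ⟨(t.truncLE a).obj X.obj, a, inferInstance⟩
    let B : DMinus R := ⟨(t.truncGE (a + 1)).obj X.obj, a + n, inferInstance⟩
    have hT := t.triangleLEGE_distinguished a (a + 1) rfl X.obj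
    have hA1 : t.IsGE A.obj a := inferInstanceAs (t.IsGE ((t.truncLE a).obj X.obj) a)
    have hA2 : t.IsLE A.obj a := inferInstanceAs (t.IsLE ((t.truncLE a).obj X.obj) a)
    have hB1 : t.IsGE B.obj (a + 1) := inferInstanceAs (t.IsGE ((t.truncGE (a + 1)).obj X.obj) _)
    have hB2 : t.IsLE B.obj (a + 1 + n - 1) := by
      rw [show a + 1 + (n : ℤ) - 1 = a + n by ring]
      exact inferInstanceAs (t.IsLE ((t.truncGE (a + 1)).obj X.obj) (a + n))
    have hAX : supp A ⊆ supp X := by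
      intro p hp
      by_contra hpX
      simp only [mem_supp_iff, not_exists] at hp hpX
      obtain ⟨i, hi⟩ := hp
      by_cases hia : i ≤ a
      · exact notMem_support_of_exact
          (DerivedCategory.HomologySequence.exact₁ _ hT (i - 1) i (by simp))
          (notMem_support_of_isZero (DerivedCategory.isZero_of_isGE B.obj (a + 1) _ (by lia)) p)
          (hpX i) hi
      · exact notMem_support_of_isZero (DerivedCategory.isZero_of_isLE A.obj a i (by lia)) p hi
    have hBX : supp B ⊆ supp X := by
      intro p hp
      by_contra hpX
      simp only [mem_supp_iff, not_exists] at hp hpX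
      obtain ⟨i, hi⟩ := hp
      by_cases hia : i ≤ a
      · exact notMem_support_of_isZero (DerivedCategory.isZero_of_isGE B.obj (a + 1) i (by lia)) p hi
      · exact notMem_support_of_exact
          (DerivedCategory.HomologySequence.exact₃ _ hT i (i + 1) (by simp)) (hpX i)
          (notMem_support_of_isZero (DerivedCategory.isZero_of_isLE A.obj a _ (by lia)) p) hi
    refine prop_mid_of_distTriang (X := A) (Y := X) (Z := B) hT ?_
      (ih (a + 1) B hB1 hB2 fun q hq => hX q (hBX hq))
    obtain ⟨M, ⟨e⟩⟩ := A.obj.exists_iso_singleFunctor_obj_of_isGE_of_isLE a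
    let e' : ((ofModule M)⟦-a⟧).obj ≅ A.obj :=
      (DerivedCategory.Minus.ι.commShiftIso (-a)).app (ofModule M) ≪≫
        ((DerivedCategory.singleFunctors (FGModuleCat.{u} R)).shiftIso (-a) a 0
          (by simp)).app M ≪≫ e.symm
    refine P.prop_of_iso (DerivedCategory.Minus.ι.preimageIso e')
      (P.le_shift (-a) _ (prop_ofModule M fun q hq => hX q (hAX ?_)))
    rwa [← supp_eq_of_obj_iso e', supp_shift, supp_ofModule]

theorem prop_of_isBounded {X : DMinus R} (hb : IsBounded X)
    (hX : ∀ q ∈ supp X, P (ofQuotient q.asIdeal)) : P X := by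
  obtain ⟨⟨a, ha⟩, ⟨b, hb⟩⟩ := hb
  refine prop_of_isGE_of_isLE (b + 1 - a).toNat a X ha ?_ hX
  exact DerivedCategory.TStructure.t.isLE_of_le _ b _ (by lia)

end Devissage

/-! ### Multiplication by elements of a complex. -/

section TensorCycles

open HomologicalComplex

variable {C : Type u} [Category.{v} C] [MonoidalCategory C] [Preadditive C]
  [MonoidalPreadditive C] {K F : CochainComplex C ℤ} [HasTensor F K]

/-- Right multiplication by a generalized element of `K` of degree `m`. -/
noncomputable def mulRight {m : ℤ} (z : 𝟙_ C ⟶ K.X m) (p q : ℤ) (h : p + m = q) :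
    F.X p ⟶ (tensorObj F K).X q :=
  (ρ_ (F.X p)).inv ≫ F.X p ◁ z ≫ ιTensorObj F K p m q h

/-- The Leibniz rule. It makes multiplication by a degree-zero cycle a chain map, and controls the
degree `-1` Koszul generator. -/
theorem mulRight_d {m : ℤ} (z : 𝟙_ C ⟶ K.X m) (p q q' : ℤ) (h : p + m = q) (hq : q + 1 = q') :
    mulRight (F := F) z p q h ≫ (tensorObj F K).d q q' =
      F.d p (p + 1) ≫ mulRight z (p + 1) q' (by lia) +
        p.negOnePow • mulRight (z ≫ K.d m (m + 1)) p q' (by lia) := by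
  simp only [mulRight, Category.assoc, ι_tensor_d F K p m q q' h hq, Preadditive.comp_add,
    Linear.comp_units_smul, MonoidalCategory.whiskerLeft_comp, whisker_exchange_assoc,
    rightUnitor_inv_naturality_assoc]

theorem mulRight_zero {m : ℤ} (p q : ℤ) (h : p + m = q) :
    mulRight (K := K) (F := F) (0 : 𝟙_ C ⟶ K.X m) p q h = 0 := by
  simp [mulRight]

/-- Right multiplication by a cycle of degree zero. -/
noncomputable def mulRightHom (z : 𝟙_ C ⟶ K.X 0) (hz : ∀ j, z ≫ K.d 0 j = 0) :
    F ⟶ tensorObj F K where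
  f p := mulRight z p p (by simp)
  comm' p q hpq := by
    obtain rfl : p + 1 = q := hpq
    rw [mulRight_d z p p (p + 1) _ rfl, hz, mulRight_zero]
    simp

end TensorCycles

/-! ### The Koszul complex of one element as a mapping cone. -/

section Koszul

open HomologicalComplex

variable {R : Type w} [CommRing R] {C : Type u} [Category.{v} C] [MonoidalCategory C]
  [Preadditive C] [Linear R C] [HasZeroObject C]

/-- The Koszul complex of one element, in degrees `-1` and `0`. -/
noncomputable def koszulCplx (C : Type u) [Category.{v} C] [MonoidalCategory C]
    [Preadditive C] [Linear R C] [HasZeroObject C] (x : R) : CochainComplex C ℤ :=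
  double (x • 𝟙 (𝟙_ C)) (show (ComplexShape.up ℤ).Rel (-1) 0 by simp)

/-- The generator of the Koszul complex in degree `-1`. -/
noncomputable def koszulIso₁ (x : R) : (koszulCplx C x).X (-1) ≅ 𝟙_ C :=
  doubleXIso₀ _ _

noncomputable def koszulIso₀ (x : R) : (koszulCplx C x).X 0 ≅ 𝟙_ C :=
  doubleXIso₁ _ _ (by simp)

theorem koszul_d (x : R) : (koszulIso₁ (C := C) x).inv ≫ (koszulCplx C x).d (-1) 0 =
    x • (koszulIso₀ (C := C) x).inv := by
  refine (congr_arg (_ ≫ ·) (double_d _ _ (by simp))).trans ?_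
  simp [koszulIso₁, koszulIso₀]
  rfl

theorem isZero_koszulCplx (x : R) (i : ℤ) (h₁ : i ≠ -1) (h₀ : i ≠ 0) :
    IsZero ((koszulCplx C x).X i) :=
  isZero_double_X _ _ _ h₁ h₀

instance (x : R) : (koszulCplx C x).IsStrictlyLE 0 := by
  rw [CochainComplex.isStrictlyLE_iff]
  intro i hi
  exact isZero_koszulCplx x i (by lia) (by lia)

open CochainComplex HomComplex

variable [MonoidalPreadditive C] [MonoidalLinear R C]

/-- Tensoring on the right with the Koszul complex of `x` is the mapping cone of multiplication by `x`. -/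
theorem exists_iso_tensor_koszul (x : R) (F : CochainComplex C ℤ)
    [HasBinaryBiproducts C] [HasTensor F (koszulCplx C x)] :
    Nonempty (mappingCone (x • 𝟙 F) ≅ tensorObj F (koszulCplx C x)) := by
  -- The sign turns the Leibniz rule into the relation `h`, by which `α` and `β` define a map out of
  -- the cone.
  let α : Cochain F (tensorObj F (koszulCplx C x)) (-1) :=
    Cochain.mk fun p q hpq =>
      p.negOnePow • mulRight (koszulIso₁ (C := C) x).inv p q (by lia)
  let β : F ⟶ tensorObj F (koszulCplx C x) := mulRightHom (koszulIso₀ (C := C) x).inv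
    fun j => by
      by_cases hj : j = 1
      · exact (isZero_koszulCplx x j (by lia) (by lia)).eq_of_tgt _ _
      · rw [(koszulCplx C x).shape 0 j (by simpa using Ne.symm hj), comp_zero]
  have h : δ (-1) 0 α = Cochain.ofHom ((x • 𝟙 F) ≫ β) := by
    ext p
    rw [δ_v (-1) 0 (by simp) α p p (by simp) (p - 1) (p + 1) (by simp) rfl]
    have h1 : α.v p (p - 1) (by lia) ≫ (tensorObj F (koszulCplx C x)).d (p - 1) p =
        x • mulRight (koszulIso₀ (C := C) x).inv p p (by simp) -
          F.d p (p + 1) ≫ α.v (p + 1) p (by lia) := by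
      have h2 := mulRight_d (F := F) (koszulIso₁ (C := C) x).inv p (p - 1) p (by lia) (by lia)
      simp only [α, Cochain.mk_v, Linear.units_smul_comp, h2]
      simp [mulRight, koszul_d, Int.negOnePow_succ, smul_smul]
      exact add_comm _ _
    rw [h1]
    simp [β, mulRightHom]
  let φ : mappingCone (x • 𝟙 F) ⟶ tensorObj F (koszulCplx C x) := mappingCone.desc _ α β h
  have hφ : ∀ n, IsIso (φ.f n) := by
    intro n
    let g : (tensorObj F (koszulCplx C x)).X n ⟶ (mappingCone (x • 𝟙 F)).X n :=
      mapBifunctorDesc fun i j (hij : i + j = n) =>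
        if hj : j = -1 then
          i.negOnePow • (F.X i ◁ ((koszulCplx C x).XIsoOfEq hj).hom ≫
            F.X i ◁ (koszulIso₁ (C := C) x).hom ≫
            (ρ_ (F.X i)).hom ≫ (mappingCone.inl (x • 𝟙 F)).v i n (by lia))
        else if hj : j = 0 then
          F.X i ◁ ((koszulCplx C x).XIsoOfEq hj).hom ≫ F.X i ◁ (koszulIso₀ (C := C) x).hom ≫
            (ρ_ (F.X i)).hom ≫ (F.XIsoOfEq (by lia)).hom ≫ (mappingCone.inr (x • 𝟙 F)).f n
        else 0
    have hg₁ : ∀ i (hi : i + -1 = n), ιTensorObj F (koszulCplx C x) i (-1) n hi ≫ g =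
        i.negOnePow • (F.X i ◁ (koszulIso₁ (C := C) x).hom ≫
            (ρ_ (F.X i)).hom ≫ (mappingCone.inl (x • 𝟙 F)).v i n (by lia)) := by
      intro i hi
      simp [g]
    have hg₀ : ιTensorObj F (koszulCplx C x) n 0 n (by simp) ≫ g =
        F.X n ◁ (koszulIso₀ (C := C) x).hom ≫ (ρ_ (F.X n)).hom ≫
          (mappingCone.inr (x • 𝟙 F)).f n := by
      simp [g]
    refine ⟨g, ?_, ?_⟩
    · apply mappingCone.ext_from _ (n + 1) n rfl
      · simp [φ, α, mulRight, hg₁, smul_smul]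
      · simp [φ, β, mulRight, mulRightHom, hg₀]
    · apply mapBifunctor.hom_ext
      intro i j hij
      replace hij : i + j = n := hij
      by_cases hj : j = -1
      · subst hj
        change ιTensorObj F _ i (-1) n hij ≫ g ≫ φ.f n = ιTensorObj F _ i (-1) n hij ≫ 𝟙 _
        rw [← Category.assoc, hg₁ i hij]
        simp [φ, α, mulRight, smul_smul]
      by_cases hj' : j = 0
      · subst hj'
        obtain rfl : i = n := (add_zero i).symm.trans hij
        change ιTensorObj F _ i 0 i hij ≫ g ≫ φ.f i = ιTensorObj F _ i 0 i hij ≫ 𝟙 _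
        rw [reassoc_of% hg₀]
        simp [φ, β, mulRight, mulRightHom]
      · exact ((tensorLeft (F.X i)).map_isZero (isZero_koszulCplx x j hj hj')).eq_of_src _ _
  have : IsIso φ := Hom.isIso_of_components φ
  exact ⟨asIso φ⟩

end Koszul

/-! ### The Koszul complex as an object of `D⁻`. -/

section KoszulObject

variable {R : Type u} [CommRing R] [IsNoetherianRing R]

instance (x : R) (i : ℤ) : Projective ((koszulCplx (FGModuleCat.{u} R) x).X i) := by
  have h : Projective (𝟙_ (FGModuleCat.{u} R)) := by
    refine ⟨fun {E X} f e he => ?_⟩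
    have he' : Epi ((forget₂ (FGModuleCat.{u} R) (ModuleCat.{u} R)).map e) := inferInstance
    obtain ⟨m, hm⟩ : ∃ m : E, e.hom.hom m = f.hom.hom (1 : R) :=
      (ModuleCat.epi_iff_surjective _).1 he' _
    refine ⟨FGModuleCat.ofHom (LinearMap.toSpanSingleton R E m), ?_⟩
    rw [← sub_eq_zero]
    refine eq_zero_of_apply_one ?_
    change e.hom.hom ((1 : R) • m) - f.hom.hom (1 : R) = 0
    rw [one_smul, hm, sub_self]
  by_cases h₁ : i = -1
  · subst h₁
    exact Projective.of_iso (koszulIso₁ x).symm h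
  by_cases h₀ : i = 0
  · subst h₀
    exact Projective.of_iso (koszulIso₀ x).symm h
  · exact (isZero_koszulCplx x i h₁ h₀).projective

/-- The Koszul complex in `D⁻`. -/
noncomputable def koszul (x : R) : DMinus R :=
  ⟨DerivedCategory.Q.obj (koszulCplx (FGModuleCat.{u} R) x), 0, inferInstance⟩

noncomputable def koszulRes (x : R) : ProjRes (koszul x) where
  cplx := koszulCplx (FGModuleCat.{u} R) x
  bound := 0
  isStrictlyLE := inferInstance
  projective := inferInstance
  iso := Iso.refl _

end KoszulObject

/-! ### Cones of scalars. -/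

section Cones

open Pretriangulated

variable {R : Type u} [CommRing R]

theorem exists_distTriang_smul_of_iso {T : Type w} [Category.{v} T] [HasZeroObject T]
    [HasShift T ℤ] [Preadditive T] [∀ n : ℤ, (shiftFunctor T n).Additive] [Pretriangulated T]
    [Linear R T] {A B X Z : T} {x : R} {g : A ⟶ B} {h : B ⟶ A⟦(1 : ℤ)⟧}
    (hT : Triangle.mk (x • 𝟙 A) g h ∈ distTriang _) (e : A ≅ X) (e' : B ≅ Z) :
    ∃ (g' : X ⟶ Z) (h' : Z ⟶ X⟦(1 : ℤ)⟧), Triangle.mk (x • 𝟙 X) g' h' ∈ distTriang _ := by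
  have h₁ : (x • 𝟙 X) ≫ e.inv = e.inv ≫ (x • 𝟙 A) := by simp
  have h₂ : (e.inv ≫ g ≫ e'.hom) ≫ e'.inv = e.inv ≫ g := by simp
  have h₃ : (e'.inv ≫ h ≫ e.hom⟦(1 : ℤ)⟧') ≫ e.inv⟦(1 : ℤ)⟧' = e'.inv ≫ h := by
    rw [Category.assoc, Category.assoc, ← Functor.map_comp, e.hom_inv_id,
      CategoryTheory.Functor.map_id, Category.comp_id]
  exact ⟨_, _, isomorphic_distinguished _ hT _
    (Triangle.isoMk _ _ e.symm e.symm e'.symm h₁ h₂ h₃)⟩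

theorem smul_id_quotient_eq_zero {I : Ideal R} {r : R} (hr : r ∈ I) :
    r • 𝟙 (FGModuleCat.of R (R ⧸ I)) = 0 := by
  refine FGModuleCat.hom_ext (LinearMap.ext fun (a : R ⧸ I) => ?_)
  change r • a = 0
  rw [Algebra.smul_def]
  change Ideal.Quotient.mk _ r * a = 0
  rw [Ideal.Quotient.eq_zero_iff_mem.2 hr, zero_mul]

variable [IsNoetherianRing R]

/-- The cone of multiplication by `x` is the tensor product with the Koszul complex of `x`. -/
theorem exists_distTriang_koszul (x : R) (X : DMinus R) :
    ∃ (g : X ⟶ derivedTensor X (koszul x)) (h : derivedTensor X (koszul x) ⟶ X⟦(1 : ℤ)⟧),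
      Triangle.mk (x • 𝟙 X) g h ∈ distTriang _ := by
  obtain ⟨F⟩ := ProjRes.nonempty X
  obtain ⟨e₁⟩ := derivedTensor_iso F (koszulRes x)
  have : HomologicalComplex.HasTensor F.cplx (koszulCplx (FGModuleCat.{u} R) x) :=
    hasTensor F.cplx _ F.bound 0
  obtain ⟨e₂⟩ := exists_iso_tensor_koszul x F.cplx
  let f := x • 𝟙 F.cplx
  have hx : DerivedCategory.Q.map f = x • 𝟙 _ := by
    rw [show f = x • 𝟙 F.cplx from rfl, Functor.map_smul, CategoryTheory.Functor.map_id]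
  have hT : Triangle.mk (DerivedCategory.Q.map f) (DerivedCategory.Q.map _)
      (DerivedCategory.Q.mapTriangle.obj (CochainComplex.mappingCone.triangle f)).mor₃ ∈
      distTriang _ :=
    DerivedCategory.mappingCone_triangle_distinguished f
  rw [hx] at hT
  obtain ⟨g, h, hT'⟩ := exists_distTriang_smul_of_iso hT (Z := (derivedTensor X (koszul x)).obj)
    F.iso (DerivedCategory.Q.mapIso e₂ ≪≫ (DerivedCategory.Minus.ι.mapIso e₁).symm)
  exact exists_distTriang_minus (X := X) (Y := X) (Z := derivedTensor X (koszul x)) (x • 𝟙 X) hT'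

theorem isBounded_koszul (x : R) : IsBounded (koszul x) := by
  have : (koszulCplx (FGModuleCat.{u} R) x).IsStrictlyGE (-1) := by
    rw [CochainComplex.isStrictlyGE_iff]
    intro i hi
    exact isZero_koszulCplx x i (by lia) (by lia)
  exact ⟨⟨-1, inferInstanceAs (DerivedCategory.IsGE (DerivedCategory.Q.obj _) (-1))⟩, 0,
    inferInstanceAs (DerivedCategory.IsLE (DerivedCategory.Q.obj _) 0)⟩

theorem isBounded_ofModule (M : FGModuleCat.{u} R) : IsBounded (ofModule M) :=
  ⟨⟨0, inferInstanceAs (DerivedCategory.IsGE ((DerivedCategory.singleFunctor _ 0).obj M) 0)⟩, 0,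
    inferInstanceAs (DerivedCategory.IsLE ((DerivedCategory.singleFunctor _ 0).obj M) 0)⟩

variable {P : ObjectProperty (DMinus R)}

/-- Otherwise dévissage puts the Koszul complex of `0` in `P`. Tensoring it with any `X` gives the
cone of zero on `X`, of which `X` is a retract, so `P` would be everything. -/
theorem exists_not_prop_ofQuotient (hP : IsPrimeThickTensorIdeal derivedTensor P) :
    ∃ q : PrimeSpectrum R, ¬ P (ofQuotient q.asIdeal) := by
  have := hP.isTriangulated
  have := hP.isStableUnderRetracts
  by_contra! h
  obtain ⟨X, hX⟩ := hP.proper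
  obtain ⟨g, h', hT⟩ := exists_distTriang_koszul (0 : R) X
  rw [zero_smul] at hT
  exact hX (prop_of_cone_zero hT
    (hP.tensor_mem _ _ (prop_of_isBounded (isBounded_koszul 0) fun q _ => h q)))

theorem ofModuleMap_smul_id (s : R) (M : FGModuleCat.{u} R) :
    ofModuleMap (s • 𝟙 M) = s • 𝟙 (ofModule M) := by
  refine DerivedCategory.Minus.ι.map_injective ?_
  change (DerivedCategory.singleFunctor _ 0).map (s • 𝟙 M) =
    s • 𝟙 ((DerivedCategory.singleFunctor _ 0).obj M)
  rw [Functor.map_smul, CategoryTheory.Functor.map_id]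

/-- As `R ⧸ p` is a domain, `s` acts injectively and its cone is the cokernel. This is killed by `p`
and by `s`, so its support lies strictly above `p`. -/
theorem exists_cone_smul_ofQuotient [P.IsTriangulated] [P.IsStableUnderRetracts]
    {p : PrimeSpectrum R} {s : R} (hs : s ∉ p.asIdeal)
    (hp : ∀ q, p < q → P (ofQuotient q.asIdeal)) :
    ∃ (Z : DMinus R) (g : ofQuotient p.asIdeal ⟶ Z) (h : Z ⟶ (ofQuotient p.asIdeal)⟦(1 : ℤ)⟧),
      Triangle.mk (s • 𝟙 (ofQuotient p.asIdeal)) g h ∈ distTriang _ ∧ P Z := by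
  let A := FGModuleCat.of R (R ⧸ p.asIdeal)
  have : Mono (s • 𝟙 A) := by
    refine Preadditive.mono_of_cancel_zero _ fun f hf => ?_
    by_contra hf0
    refine smul_ne_zero_of_notMem hs hf0 ?_
    rw [← hf, Linear.comp_smul, Category.comp_id]
  let S : ShortComplex (FGModuleCat.{u} R) := ShortComplex.mk _ _ (cokernel.condition (s • 𝟙 A))
  have hS : S.ShortExact := ⟨ShortComplex.exact_cokernel _⟩
  obtain ⟨g, h, hT⟩ := exists_distTriang_ofModule hS
  refine ⟨_, g, h, (ofModuleMap_smul_id s A) ▸ hT, prop_ofModule _ fun q hq => hp q ?_⟩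
  have key : ∀ r : R, r • 𝟙 A ≫ S.g = 0 → r ∈ q.asIdeal := by
    intro r hr
    by_contra hrq
    refine (notMem_support_iff_exists_smul_id _ q).2 ⟨r, hrq, ?_⟩ hq
    rw [← cancel_epi S.g, comp_zero, Linear.comp_smul, Category.comp_id]
    simpa using hr
  refine lt_of_le_of_ne (fun r hr => key r ?_) ?_
  · have : r • 𝟙 A = 0 := smul_id_quotient_eq_zero hr
    rw [← Linear.smul_comp, this, zero_comp]
  · rintro rfl
    refine hs (key s ?_)
    rw [← Linear.smul_comp]
    exact cokernel.condition (s • 𝟙 A)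

end Cones

/-! ### Factoring a scalar on `R ⧸ p` through a tensor product. -/

section Factorization

open Pretriangulated HomologicalComplex

theorem exists_Q_map_eq {C : Type u} [Category.{v} C] [Abelian C] [HasDerivedCategory.{w} C]
    (K L : CochainComplex C ℤ) [K.IsKProjective]
    (φ : DerivedCategory.Q.obj K ⟶ DerivedCategory.Q.obj L) :
    ∃ f : K ⟶ L, DerivedCategory.Q.map f = φ := by
  obtain ⟨f, hf⟩ := (CochainComplex.IsKProjective.Qh_map_bijective K
    ((HomotopyCategory.quotient _ _).obj L)).surjective
      ((DerivedCategory.quotientCompQhIso C).hom.app K ≫ φ ≫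
        (DerivedCategory.quotientCompQhIso C).inv.app L)
  obtain ⟨f, rfl⟩ := (HomotopyCategory.quotient _ _).map_surjective f
  refine ⟨f, ?_⟩
  rw [← cancel_epi ((DerivedCategory.quotientCompQhIso C).hom.app K),
    ← cancel_mono ((DerivedCategory.quotientCompQhIso C).inv.app L), Category.assoc, Category.assoc,
    ← hf, ← (DerivedCategory.quotientCompQhIso C).hom.naturality_assoc]
  simp

variable {R : Type u} [CommRing R]

/-- Multiplication by an element of `R ⧸ I` is multiplication by any representative of it. -/
theorem exists_whiskerLeft_comp_mul_eq_smul (I : Ideal R)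
    (t : 𝟙_ (FGModuleCat.{u} R) ⟶ FGModuleCat.of R (R ⧸ I)) (ht : t ≠ 0) :
    ∃ s ∉ I, (ρ_ (FGModuleCat.of R (R ⧸ I))).inv ≫ FGModuleCat.of R (R ⧸ I) ◁ t ≫
      (show FGModuleCat.of R (R ⧸ I) ⊗ FGModuleCat.of R (R ⧸ I) ⟶ FGModuleCat.of R (R ⧸ I) from
        FGModuleCat.ofHom (LinearMap.mul' R (R ⧸ I))) = s • 𝟙 _ := by
  obtain ⟨s, hs⟩ := Ideal.Quotient.mk_surjective (t.hom.hom (1 : R) : R ⧸ I)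
  refine ⟨s, fun h => ht (eq_zero_of_apply_one ?_), ?_⟩
  · exact hs.symm.trans (Ideal.Quotient.eq_zero_iff_mem.2 h)
  · refine FGModuleCat.hom_ext (LinearMap.ext fun (a : R ⧸ I) => ?_)
    change a * (t.hom.hom (1 : R) : R ⧸ I) = s • a
    rw [← hs, mul_comm, Algebra.smul_def]
    rfl

variable [IsNoetherianRing R]

/-- If `l` is a functional on `F.X 0` killing boundaries and `z` is a cycle, then multiplication by
`l z` factors through the tensor product. -/
theorem exists_mulRightHom_comp {G F : CochainComplex (FGModuleCat.{u} R) ℤ} [HasTensor G F]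
    (I : Ideal R)
    (ε : G ⟶ (single _ (ComplexShape.up ℤ) 0).obj (FGModuleCat.of R (R ⧸ I)))
    (z : 𝟙_ (FGModuleCat.{u} R) ⟶ F.X 0) (hz : ∀ j, z ≫ F.d 0 j = 0)
    (l : F.X 0 ⟶ FGModuleCat.of R (R ⧸ I)) (hl : ∀ i, F.d i 0 ≫ l = 0) (hzl : z ≫ l ≠ 0) :
    ∃ s ∉ I, ∃ g : tensorObj G F ⟶ (single _ (ComplexShape.up ℤ) 0).obj _,
      mulRightHom z hz ≫ g = s • ε := by
  let A := FGModuleCat.of R (R ⧸ I)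
  let mul : A ⊗ A ⟶ A := FGModuleCat.ofHom (LinearMap.mul' R (R ⧸ I))
  obtain ⟨s, hs, hst⟩ := exists_whiskerLeft_comp_mul_eq_smul I (z ≫ l) hzl
  replace hst : (ρ_ A).inv ≫ A ◁ (z ≫ l) ≫ mul = s • 𝟙 A := hst
  let ε₀ : G.X 0 ⟶ A := ε.f 0 ≫ (singleObjXSelf (ComplexShape.up ℤ) 0 A).hom
  have hε : ∀ i, G.d i 0 ≫ ε₀ = 0 := fun i => by
    rw [← Category.assoc, ← ε.comm, single_obj_d, comp_zero, zero_comp]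
  obtain ⟨g, hg, hdg, -⟩ := exists_tensor_desc (F := G) (G := F) 0 0 0 rfl ((ε₀ ⊗ₘ l) ≫ mul)
    (fun i => by
      rw [MonoidalCategory.tensorHom_def, Category.assoc, ← comp_whiskerRight_assoc, hε]
      simp)
    (fun j => by
      rw [MonoidalCategory.tensorHom_def', Category.assoc, ← whiskerLeft_comp_assoc, hl]
      simp)
  refine ⟨s, hs, mkHomToSingle g fun i hi => ?_, ?_⟩
  · obtain rfl : i = 0 - 1 := by
      simp only [ComplexShape.up_Rel] at hi
      lia
    exact hdg
  · apply to_single_hom_ext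
    have h1 : mulRight (F := G) z 0 0 (by simp) ≫ g = s • ε₀ := by
      rw [mulRight, Category.assoc, Category.assoc, hg, MonoidalCategory.tensorHom_def,
        Category.assoc, whisker_exchange_assoc, ← rightUnitor_inv_naturality_assoc,
        ← whiskerLeft_comp_assoc, hst, Linear.comp_smul, Category.comp_id]
    rw [comp_f, mkHomToSingle_f]
    change mulRight z 0 0 _ ≫ g ≫ _ = s • ε.f 0
    rw [← Category.assoc, h1]
    simp [ε₀]

/-- Multiply by a degree-zero cycle `z` of `X`, then apply a functional `l` with `l z` nonzero
modulo `p`. The composite is a representative `s` of `l z`; `hmax` is what allows `l` to kill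
boundaries. -/
theorem exists_smul_id_factor (X : DMinus R) (p : PrimeSpectrum R)
    (h0 : p ∈ Module.support R (cohomology X 0))
    (hmax : ∀ i, 0 < i → p ∉ Module.support R (cohomology X i)) :
    ∃ s ∉ p.asIdeal, ∃ (f : ofQuotient p.asIdeal ⟶ derivedTensor (ofQuotient p.asIdeal) X)
      (g : derivedTensor (ofQuotient p.asIdeal) X ⟶ ofQuotient p.asIdeal), f ≫ g = s • 𝟙 _ := by
  obtain ⟨F⟩ := ProjRes.nonempty X
  obtain ⟨G⟩ := ProjRes.nonempty (ofQuotient p.asIdeal)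
  obtain ⟨e⟩ := derivedTensor_iso G F
  obtain ⟨z, l, hz, hl, hzl⟩ := exists_cycle_functional F.cplx F.bound p 0
    (by rwa [support_homology_eq_of_iso F.iso])
    fun i hi => by
      rw [support_homology_eq_of_iso F.iso]
      exact hmax i hi
  let A := FGModuleCat.of R (R ⧸ p.asIdeal)
  let c : (ofQuotient p.asIdeal).obj ≅ DerivedCategory.Q.obj ((single _ _ 0).obj A) :=
    (DerivedCategory.singleFunctorIsoCompQ _ 0).app A
  obtain ⟨ε, hε⟩ := exists_Q_map_eq _ _ (G.iso.hom ≫ c.hom)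
  have hz' : ∀ j, z ≫ F.cplx.d 0 j = 0 := fun j => by
    by_cases hj : j = 0 + 1
    · rw [hj, hz]
    · rw [F.cplx.shape 0 j (by simpa using Ne.symm hj), comp_zero]
  obtain ⟨s, hs, g, hg⟩ := exists_mulRightHom_comp p.asIdeal ε z hz' l hl hzl
  let f' : ofQuotient p.asIdeal ⟶ G.tensor F :=
    ObjectProperty.homMk (G.iso.inv ≫ DerivedCategory.Q.map (mulRightHom z hz'))
  let g' : G.tensor F ⟶ ofQuotient p.asIdeal :=
    ObjectProperty.homMk (DerivedCategory.Q.map g ≫ c.inv)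
  have hfg : f' ≫ g' = s • 𝟙 _ := by
    apply DerivedCategory.Minus.ι.map_injective
    change (G.iso.inv ≫ DerivedCategory.Q.map _) ≫ DerivedCategory.Q.map g ≫ c.inv =
      s • 𝟙 (ofQuotient p.asIdeal).obj
    rw [Category.assoc, ← Functor.map_comp_assoc, hg, Functor.map_smul, hε, Linear.smul_comp,
      Linear.comp_smul, Category.assoc, Iso.inv_hom_id_assoc]
    exact congr_arg (s • ·) c.hom_inv_id
  exact ⟨s, hs, f' ≫ e.inv, e.hom ≫ g', by simpa using hfg⟩

end Factorization

/-! ### The prime ideal attached to a prime thick tensor ideal. -/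

section Primes

open Pretriangulated

variable {R : Type u} [CommRing R] [IsNoetherianRing R] {P : ObjectProperty (DMinus R)}

theorem notMem_supp_of_prop (hP : IsThickTensorIdeal derivedTensor P) {m : PrimeSpectrum R}
    (hm : ¬ P (ofQuotient m.asIdeal)) (hm' : ∀ q, m < q → P (ofQuotient q.asIdeal))
    {X : DMinus R} (hX : P X) : m ∉ supp X := by
  have := hP.isTriangulated
  have := hP.isStableUnderRetracts
  intro hmX
  obtain ⟨F⟩ := ProjRes.nonempty X
  obtain ⟨k, hk⟩ := (mem_supp_iff_of_iso F.iso).1 hmX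
  obtain ⟨n, hn, hn'⟩ := exists_top_support_homology F.cplx F.bound m k hk
  simp only [support_homology_eq_of_iso F.iso] at hn hn'
  obtain ⟨s, hs, f, g, hfg⟩ := exists_smul_id_factor (X⟦n⟧) m
    (by rwa [support_cohomology_shift, add_zero])
    fun i hi => by
      rw [support_cohomology_shift]
      exact hn' _ (by lia)
  obtain ⟨Z, c, h, hT, hZ⟩ := exists_cone_smul_ofQuotient hs hm'
  rw [← hfg] at hT
  exact hm (prop_of_factor f g hT (hP.tensor_mem _ _ (P.le_shift n _ hX)) hZ)

/-- For a prime thick tensor ideal `P` there is at most one prime ideal `m` which is maximal such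
that `R ⧸ m` is not in `P`. -/
theorem le_of_maximal (hP : IsPrimeThickTensorIdeal derivedTensor P) {p q : PrimeSpectrum R}
    (hp : ¬ P (ofQuotient p.asIdeal)) (hp' : ∀ r, p < r → P (ofQuotient r.asIdeal))
    (hq : ¬ P (ofQuotient q.asIdeal)) : q ≤ p := by
  have := hP.isTriangulated
  have := hP.isStableUnderRetracts
  intro x hxq
  by_contra hxp
  obtain ⟨Z, c, h, hT, hZ⟩ := exists_cone_smul_ofQuotient hxp hp'
  obtain ⟨c', h', hT'⟩ := exists_distTriang_koszul x (ofQuotient p.asIdeal)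
  -- Both triangles are cones of `x` on `R ⧸ p`, so `R ⧸ p ⊗ K(x)` is in `P`, and primeness then
  -- gives `K(x) ∈ P`.
  let e := isoTriangleOfIso₁₂ _ _ hT hT' (Iso.refl _) (Iso.refl _)
    ((Category.comp_id _).trans (Category.id_comp _).symm)
  have hK := (hP.mem_or_mem _ _ (P.prop_of_iso (Triangle.π₃.mapIso e) hZ)).resolve_left hp
  obtain ⟨c'', h'', hT''⟩ := exists_distTriang_koszul x (ofQuotient q.asIdeal)
  have hx : x • 𝟙 (ofQuotient q.asIdeal) = 0 := by
    rw [← ofModuleMap_smul_id]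
    rw [smul_id_quotient_eq_zero hxq]
    refine DerivedCategory.Minus.ι.map_injective ?_
    exact CategoryTheory.Functor.map_zero (DerivedCategory.singleFunctor (FGModuleCat.{u} R) 0) _ _
  rw [hx] at hT''
  exact hq (prop_of_cone_zero hT'' (hP.tensor_mem _ _ hK))

theorem exists_maximal_not_prop (hP : IsPrimeThickTensorIdeal derivedTensor P) :
    ∃ m : PrimeSpectrum R, ¬ P (ofQuotient m.asIdeal) ∧
      ∀ q, m < q → P (ofQuotient q.asIdeal) := by
  obtain ⟨q, hq⟩ := exists_not_prop_ofQuotient hP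
  obtain ⟨m, hm, hmax⟩ := (InvImage.wf PrimeSpectrum.asIdeal
    (wellFounded_gt (α := Ideal R))).has_min {q | ¬ P (ofQuotient q.asIdeal)} ⟨q, hq⟩
  exact ⟨m, hm, fun r hr => by_contra fun h => hmax r h hr⟩

theorem specializes_supp {X : DMinus R} {p q : PrimeSpectrum R} (hpq : p ≤ q) (hp : p ∈ supp X) :
    q ∈ supp X := by
  obtain ⟨n, hn⟩ := mem_supp_iff.1 hp
  exact mem_supp_iff.2 ⟨n, Module.mem_support_mono hpq hn⟩

theorem supp_ofQuotient (I : Ideal R) : supp (ofQuotient I) = PrimeSpectrum.zeroLocus (I : Set R) := by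
  ext p
  rw [supp_ofModule, Module.mem_support_iff_of_finite]
  change Module.annihilator R (R ⧸ I) ≤ _ ↔ _
  rw [Ideal.annihilator_quotient]
  rfl

/-- The support of a prime thick tensor ideal is the set of primes not contained in a certain
prime. -/
theorem exists_suppClass_eq (hP : IsPrimeThickTensorIdeal derivedTensor P) :
    ∃ m : PrimeSpectrum R, (∀ q, P (ofQuotient q.asIdeal) ↔ ¬ q ≤ m) ∧
      suppClass P = {p | ¬ p.asIdeal ≤ m.asIdeal} := by
  obtain ⟨m, hm, hm'⟩ := exists_maximal_not_prop hP
  have hX : ∀ X, P X → m ∉ supp X := fun X => notMem_supp_of_prop hP.toIsThickTensorIdeal hm hm'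
  have hq : ∀ q, P (ofQuotient q.asIdeal) ↔ ¬ q ≤ m := by
    refine fun q => ⟨fun h hqm => hX _ h ?_, fun h => ?_⟩
    · rw [supp_ofQuotient]
      exact hqm
    · by_contra h'
      exact h (le_of_maximal hP hm hm' h')
  refine ⟨m, hq, ?_⟩
  ext p
  simp only [suppClass, Set.mem_iUnion, exists_prop]
  refine ⟨fun ⟨X, hPX, hp⟩ hpm => hX X hPX (specializes_supp hpm hp), fun h => ?_⟩
  refine ⟨_, (hq p).2 h, ?_⟩
  rw [supp_ofQuotient]
  exact le_refl p.asIdeal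

end Primes

/-! ### Properties of the comparison map. -/

section ComparisonMap

variable {R : Type u} [CommRing R] [IsNoetherianRing R]

theorem IsComparisonMap.eq {ρ ρ' : SpcDMinus R → PrimeSpectrum R} (h : IsComparisonMap ρ)
    (h' : IsComparisonMap ρ') : ρ' = ρ := by
  funext P
  have key : ∀ q : PrimeSpectrum R, q ≤ ρ P ↔ q ≤ ρ' P := by
    intro q
    have := Set.ext_iff.1 ((h P).symm.trans (h' P)) q
    exact not_iff_not.1 this
  exact le_antisymm ((key _).2 le_rfl) ((key _).1 le_rfl)

theorem IsComparisonMap.prop_ofQuotient_iff {ρ : SpcDMinus R → PrimeSpectrum R}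
    (h : IsComparisonMap ρ) (P : SpcDMinus R) (q : PrimeSpectrum R) :
    P.1 (ofQuotient q.asIdeal) ↔ ¬ q ≤ ρ P := by
  obtain ⟨m, hm, hPm⟩ := exists_suppClass_eq P.2
  have : ρ P = m := by
    have key : ∀ q : PrimeSpectrum R, q ≤ ρ P ↔ q ≤ m := fun q =>
      not_iff_not.1 (Set.ext_iff.1 ((h P).symm.trans hPm) q)
    exact le_antisymm ((key _).1 le_rfl) ((key _).2 le_rfl)
  rw [this, hm]

/-- This is the inequality `P ≤ localPrime (ρ P)`: the local prime is the top of the fibre. -/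
theorem IsComparisonMap.notMem_supp {ρ : SpcDMinus R → PrimeSpectrum R}
    (h : IsComparisonMap ρ) (P : SpcDMinus R) {X : DMinus R} (hX : P.1 X) : ρ P ∉ supp X := by
  intro hp
  have h1 : ρ P ∈ suppClass P.1 := Set.mem_iUnion₂.2 ⟨X, hX, hp⟩
  rw [h P] at h1
  exact h1 le_rfl

theorem exists_isComparisonMap (R : Type u) [CommRing R] [IsNoetherianRing R] :
    ∃ ρ : SpcDMinus R → PrimeSpectrum R, IsComparisonMap ρ :=
  ⟨fun P => (exists_suppClass_eq P.2).choose, fun P => (exists_suppClass_eq P.2).choose_spec.2⟩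

/-- If `ρ P` is outside the specialization-closed set `supp X`, no `q` in it lies below `ρ P`, so
every such `R ⧸ q` is in `P` and dévissage applies. Boundedness enters here. -/
theorem IsComparisonMap.spp_eq {ρ : SpcDMinus R → PrimeSpectrum R} (h : IsComparisonMap ρ)
    {X : DMinus R} (hX : IsBounded X) : spp derivedTensor X = ρ ⁻¹' supp X := by
  ext P
  refine ⟨fun hP => ?_, fun hP hPX => h.notMem_supp P hPX hP⟩
  by_contra hρ
  have := P.2.isTriangulated
  have := P.2.isStableUnderRetracts
  refine hP (prop_of_isBounded hX fun q hq => ?_)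
  rw [h.prop_ofQuotient_iff]
  exact fun hqρ => hρ (specializes_supp hqρ hq)

/-- The prime thick tensor ideal of complexes which vanish locally at `p`. -/
def localPrime (p : PrimeSpectrum R) : SpcDMinus R :=
  ⟨localAcyclic p, isPrimeThickTensorIdeal_localAcyclic p⟩

theorem IsComparisonMap.apply_localPrime {ρ : SpcDMinus R → PrimeSpectrum R}
    (h : IsComparisonMap ρ) (p : PrimeSpectrum R) : ρ (localPrime p) = p := by
  have key : ∀ q : PrimeSpectrum R, q ≤ ρ (localPrime p) ↔ q ≤ p := by
    intro q
    rw [← not_iff_not, ← h.prop_ofQuotient_iff]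
    change p ∉ supp _ ↔ _
    rw [supp_ofQuotient]
    rfl
  exact le_antisymm ((key _).1 le_rfl) ((key _).2 le_rfl)

theorem localPrime_antitone {p q : PrimeSpectrum R} (h : p ≤ q) : localPrime q ≤ localPrime p :=
  fun _ hX hp => hX (specializes_supp h hp)

theorem IsComparisonMap.continuous {ρ : SpcDMinus R → PrimeSpectrum R} (h : IsComparisonMap ρ) :
    Continuous ρ := by
  rw [continuous_iff_isClosed]
  intro Z hZ
  obtain ⟨I, rfl⟩ := (PrimeSpectrum.isClosed_iff_zeroLocus_ideal Z).1 hZ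
  -- A closed set `V(I)` is the support of the bounded object `R ⧸ I`, so its preimage is a Balmer
  -- support.
  rw [← supp_ofQuotient, ← h.spp_eq (isBounded_ofModule _)]
  exact isClosed_spp _

theorem isClosed_supp {X : DMinus R} (hX : IsBounded X) : IsClosed (supp X) := by
  obtain ⟨⟨a, ha⟩, ⟨b, hb⟩⟩ := hX
  have : supp X = ⋃ n ∈ Set.Icc a b, Module.support R (cohomology X n) := by
    ext p
    simp only [mem_supp_iff, Set.mem_iUnion, exists_prop]
    refine ⟨fun ⟨n, hn⟩ => ⟨n, ⟨?_, ?_⟩, hn⟩, fun ⟨n, _, hn⟩ => ⟨n, hn⟩⟩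
    · by_contra! hna
      exact notMem_support_of_isZero (DerivedCategory.isZero_of_isGE X.obj a n hna) p hn
    · by_contra! hnb
      exact notMem_support_of_isZero (DerivedCategory.isZero_of_isLE X.obj b n hnb) p hn
  rw [this]
  refine (Set.finite_Icc a b).isClosed_biUnion fun n _ => ?_
  rw [Module.support_eq_zeroLocus]
  exact PrimeSpectrum.isClosed_zeroLocus _

end ComparisonMap

end TTGeom

theorem theorem3p6 (R : Type u) [CommRing R] [IsNoetherianRing R] :
    ∃ ρ : TTGeom.SpcDMinus R → PrimeSpectrum R,
      TTGeom.IsComparisonMap ρ ∧ (∀ ρ', TTGeom.IsComparisonMap ρ' → ρ' = ρ) ∧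
      Continuous ρ ∧ Function.Surjective ρ ∧
      ∀ C : TTGeom.DMinus R, TTGeom.IsBounded C →
        -- connected components
        (Set.BijOn (fun U => ρ '' U)
            (TTGeom.connComponents (TTGeom.spp TTGeom.derivedTensor C))
            (TTGeom.connComponents (TTGeom.supp C)) ∧
          Set.BijOn (fun W => ρ ⁻¹' W)
            (TTGeom.connComponents (TTGeom.supp C))
            (TTGeom.connComponents (TTGeom.spp TTGeom.derivedTensor C)) ∧
          Set.InvOn (fun W => ρ ⁻¹' W) (fun U => ρ '' U)
            (TTGeom.connComponents (TTGeom.spp TTGeom.derivedTensor C))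
            (TTGeom.connComponents (TTGeom.supp C))) ∧
        -- irreducible components
        (Set.BijOn (fun U => ρ '' U)
            (TTGeom.irredComponents (TTGeom.spp TTGeom.derivedTensor C))
            (TTGeom.irredComponents (TTGeom.supp C)) ∧
          Set.BijOn (fun W => ρ ⁻¹' W)
            (TTGeom.irredComponents (TTGeom.supp C))
            (TTGeom.irredComponents (TTGeom.spp TTGeom.derivedTensor C)) ∧
          Set.InvOn (fun W => ρ ⁻¹' W) (fun U => ρ '' U)
            (TTGeom.irredComponents (TTGeom.spp TTGeom.derivedTensor C))
            (TTGeom.irredComponents (TTGeom.supp C))) ∧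
        -- maximal elements of `Spp C` and minimal elements of `Supp C`
        (Set.BijOn ρ {P | Maximal (fun Q => Q ∈ TTGeom.spp TTGeom.derivedTensor C) P}
            {p | Minimal (fun q => q ∈ TTGeom.supp C) p} ∧
          Set.BijOn (fun P => closure {P})
            {P | Maximal (fun Q => Q ∈ TTGeom.spp TTGeom.derivedTensor C) P}
            (TTGeom.irredComponents (TTGeom.spp TTGeom.derivedTensor C)) ∧
          Set.BijOn (fun p => closure {p}) {p | Minimal (fun q => q ∈ TTGeom.supp C) p}
            (TTGeom.irredComponents (TTGeom.supp C)) ∧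
          ∀ P, Maximal (fun Q => Q ∈ TTGeom.spp TTGeom.derivedTensor C) P →
            ρ '' closure {P} = closure {ρ P}) := by
  obtain ⟨ρ, hρ⟩ := TTGeom.exists_isComparisonMap R
  refine ⟨ρ, hρ, fun ρ' hρ' => hρ.eq hρ', hρ.continuous,
    fun p => ⟨TTGeom.localPrime p, hρ.apply_localPrime p⟩, fun C hC => ?_⟩
  rw [hρ.spp_eq hC]
  refine TTGeom.components_transfer TTGeom.closure_singleton_eq_Iic hρ.continuous
    hρ.apply_localPrime (fun P X hX => hρ.notMem_supp P hX) (fun P Q hPQ => ?_)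
    (fun p q => TTGeom.localPrime_antitone) (TTGeom.isClosed_supp hC)
  -- `ρ` reverses order: otherwise `R ⧸ ρ Q` would lie in `P`, hence in `Q`, which is impossible.
  by_contra h
  rw [← hρ.prop_ofQuotient_iff] at h
  exact (hρ.prop_ofQuotient_iff Q (ρ Q)).1 (hPQ _ h) le_rfl
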